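/- Let $G=(V,E)$ be a finite simple graph with edge weights $w:E\to\mathbb R$. A \emph{dual solution} $y$ gives a number $y_v$ to every vertex and $y_S$ to every odd set $S\subseteq V$ with $|S|>1$; $\mathrm{slack}(uv)=w_{uv}-y_u-y_v-\sum_{S:\,uv\in\delta(S)}y_S$, and $y$ is \emph{feasible} if all slacks are $\ge 0$ and all $y_S\ge 0$ $(|S|>1)$. An edge is \emph{tight} if its slack is $0$. \emph{Cherry forests.} Let $H$ be a graph, possibly obtained by contracting disjoint vertex sets (its nodes are then the contracted sets, its edges are original edges), with a matching $M$ and sets of plus-nodes and minus-nodes (nodes in both are $\pm$-nodes, nodes in neither are free, plus-nodes that are not minus-nodes are purely plus-nodes, and similarly for purely minus-nodes). Unmatched nodes are called roots and are purely plus-nodes; every other plus-node has a matched incident edge as plus-parent, and every minus-node an unmatched incident edge as minus-parent. For a plus-node (minus-node) $v$ let $\mathcal P^+_v$ ($\mathcal P^-_v$) be the path from $v$ that follows plus- and minus-parents in alternation, starting with the plus-parent (minus-parent) of $v$. This is a \emph{cherry forest} if all these paths are simple and end at a root, and every $\pm$-node $v$ has a purely plus-node $\mathfrak r_v$, its receptacle,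 which lies on $\mathcal P^+_v$ and $\mathcal P^-_v$ and before which all nodes of these paths are $\pm$-nodes. The \emph{tree} of a root $r$ consists of the nodes whose paths end at $r$. The \emph{cherry blossom} of a purely plus-node $x$ consists of $x$ and all $\pm$-nodes $v$ with $\mathfrak r_v=x$. \emph{States.} A state of Blossom VI consists of a laminar family of supernodes (vertex sets with more than one vertex), a feasible $y$ with $y_S=0$ for all $S$ with $|S|>1$ that are not supernodes, and matchings and cherry forests, with all matched edges and all parents tight, on the current graph (in which the maximal supernodes are contracted) and inside each supernode (with its maximal sub-supernodes contracted). Here every supernode has an odd number of elements, exactly one of them unmatched inside it, and all others $\pm$-nodes of its cherry forest; and in the current graph the mate of every minus-node is a plus-node. A state of a traditional multi-tree blossom algorithm is the same, except that the current graph carries an ordinary alternating forest (no $\pm$-nodes) and each contracted set is a traditional blossom: its $2k+1\ge 3$ elements form an odd cycle of tight edges, $k$ of which are matched, and the matched edges between its elements form a matching. \emph{Updates.} Primal updates of Blossom VI are possible in these cases, all in the current graph: (grow-out) a tight edge joins a plus-node to a free node whose mate is free; (grow-in) a tight edge joins two plus-nodes of the same tree in different cherry blossoms; (augment) a tight edge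 joins plus-nodes of different trees; (shrink) some cherry blossom has more than one node; (expand) some purely minus-node is a supernode with zero dual variable. For the traditional algorithm they are grow, augment and expand as above, and shrink when a tight edge joins two different plus-nodes of one tree. If the current graph has no $\pm$-nodes, a dual update chooses $\delta_T\ge 0$ for each tree $T$, adds $\delta_T$ to $y$ on plus-nodes of $T$ and subtracts it on minus-nodes of $T$, so that $y$ remains feasible; it makes progress if $\delta\ne 0$ and no other feasible choice $\delta'$ satisfies $\delta'\ge\delta$ (so there is no progress if only $\delta=0$ is feasible, or if feasible $\delta$ can be increased forever). A state is \emph{stuck} if there is at least one tree, no primal update is possible, and no dual update makes progress. Then: (1) For every cherry forest and every purely plus-node $x$ of it, the contraction of the cherry blossom of $x$ to a single node is the result of a (possibly empty) sequence of traditional blossom shrinks, each contracting an odd alternating cycle ($2k+1\ge3$ nodes, $k$ matched edges) whose unmatched-in-the-cycle node is $x$ or the node into which $x$ has been contracted. (2) Every state of Blossom VI is realized by a state of a traditional multi-tree blossom algorithm with the same matched edges and the same dual solution, whose blossoms include all supernodes, and whose current nodes, with their labels and parents, are those obtained by shrinking all cherry blossoms of the current graph (a shrunk cherry blossom takes over the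 labels and the parent of its receptacle). If the state of Blossom VI is stuck, so is this state of the traditional algorithm. (3) If a state of Blossom VI is stuck, then $G$ has no perfect matching. -/

import Mathlib

namespace Blossom

/-! The input is a finite simple graph `G` on `V` with edge weights `w : Sym2 V → ℝ`.
A *node* of a contracted graph is identified with the set of input vertices it stands for;
an edge of a contracted graph is an edge of the input graph joining two different nodes. -/

/-! ### Dual variables and slacks -/

/-- The slack `w_e - y_u - y_v - ∑ y_S` of `e = ab`, the sum being over the odd sets `S` with more
than one vertex and `e ∈ δ(S)`. The variable of a vertex `v` is `y {v}`. -/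
def slack {V : Type*} [Fintype V] [DecidableEq V] (w : Sym2 V → ℝ) (y : Finset V → ℝ)
    (a b : V) : ℝ :=
  w s(a, b) - y {a} - y {b}
    - ∑ S : Finset V with Odd S.card ∧ 1 < S.card ∧ (a ∈ S ∧ b ∉ S ∨ b ∈ S ∧ a ∉ S), y S

theorem slack_comm {V : Type*} [Fintype V] [DecidableEq V] (w : Sym2 V → ℝ) (y : Finset V → ℝ)
    (a b : V) : slack w y a b = slack w y b a := by
  unfold slack
  rw [Sym2.eq_swap, sub_right_comm (w s(b, a))]
  simp only [or_comm]

/-- The graph `(V, E₀)` of the edges of zero slack. -/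
def tightGraph {V : Type*} [Fintype V] [DecidableEq V] (G : SimpleGraph V) (w : Sym2 V → ℝ)
    (y : Finset V → ℝ) : SimpleGraph V where
  Adj a b := G.Adj a b ∧ slack w y a b = 0
  symm := ⟨fun a b h => ⟨h.1.symm, by rw [slack_comm]; exact h.2⟩⟩
  loopless := ⟨fun a h => G.loopless.irrefl a h.1⟩

/-- Feasibility for the dual linear program. -/
def DualFeasible {V : Type*} [Fintype V] [DecidableEq V] (G : SimpleGraph V) (w : Sym2 V → ℝ)
    (y : Finset V → ℝ) : Prop :=
  (∀ a b, G.Adj a b → 0 ≤ slack w y a b) ∧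
    ∀ S : Finset V, Odd S.card → 1 < S.card → 0 ≤ y S

/-! ### Nodes -/

/-- All nodes: the vertices of the input graph and the supernodes in `𝓑`. -/
def nodes {V : Type*} [Fintype V] [DecidableEq V] (𝓑 : Finset (Finset V)) :
    Finset (Finset V) :=
  Finset.univ.image (fun v : V => {v}) ∪ 𝓑

/-- The nodes of the current graph: those not contained in a larger node. -/
def topNodes {V : Type*} [Fintype V] [DecidableEq V] (𝓑 : Finset (Finset V)) :
    Finset (Finset V) :=
  (nodes 𝓑).filter fun S => ∀ T ∈ nodes 𝓑, ¬ S ⊂ T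

/-- The elements of the supernode `B`, i.e. the largest nodes properly contained in it. -/
def children {V : Type*} [Fintype V] [DecidableEq V] (𝓑 : Finset (Finset V)) (B : Finset V) :
    Finset (Finset V) :=
  (nodes 𝓑).filter fun S => S ⊂ B ∧ ∀ T ∈ nodes 𝓑, S ⊂ T → ¬ T ⊂ B

/-- Contracted sets are non-trivial and nested or disjoint. -/
def IsLaminar {V : Type*} (𝓑 : Finset (Finset V)) : Prop :=
  (∀ B ∈ 𝓑, 1 < B.card) ∧ ∀ A ∈ 𝓑, ∀ B ∈ 𝓑, A ⊆ B ∨ B ⊆ A ∨ Disjoint A B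

/-- The node set of a contracted graph: non-empty, pairwise disjoint sets of vertices. -/
def IsNodeSet {V : Type*} (𝒩 : Finset (Finset V)) : Prop :=
  (∀ u ∈ 𝒩, u.Nonempty) ∧ ∀ u ∈ 𝒩, ∀ v ∈ 𝒩, u ≠ v → Disjoint u v

/-! ### Matchings, labels and parents -/

/-- Matched edges, plus- and minus-nodes, plus- and minus-parents. A parent `(a, b)` of a node
`u` is an arc with `a ∈ u` that leads to the node containing `b`.
The data of all contracted graphs (the current one and those inside the supernodes) are kept
together: each edge joins different nodes in exactly one of them. -/
structure AltData (V : Type*) where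
  M : Finset (Sym2 V)
  plus : Finset (Finset V)
  minus : Finset (Finset V)
  plusParent : Finset V → V × V
  minusParent : Finset V → V × V

namespace AltData

variable {V : Type*}

/-- In the graph obtained from `H` with node set `𝒩`, the edges of `M` form a matching. -/
def IsMatching (D : AltData V) (H : SimpleGraph V) (𝒩 : Finset (Finset V)) : Prop :=
  (∀ u ∈ 𝒩, ∀ v ∈ 𝒩, u ≠ v → ∀ a ∈ u, ∀ b ∈ v, s(a, b) ∈ D.M → H.Adj a b) ∧
    ∀ u ∈ 𝒩, ∀ v ∈ 𝒩, ∀ v' ∈ 𝒩, u ≠ v → u ≠ v' →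
      ∀ a ∈ u, ∀ b ∈ v, ∀ a' ∈ u, ∀ b' ∈ v',
        s(a, b) ∈ D.M → s(a', b') ∈ D.M → a = a' ∧ b = b'

/-- `x` and `y` are the end nodes of a matched edge. -/
def Mates (D : AltData V) (x y : Finset V) : Prop :=
  x ≠ y ∧ ∃ a ∈ x, ∃ b ∈ y, s(a, b) ∈ D.M

/-- A root is an unmatched node. -/
def IsRoot (D : AltData V) (𝒩 : Finset (Finset V)) (r : Finset V) : Prop :=
  r ∈ 𝒩 ∧ ∀ v ∈ 𝒩, ¬ D.Mates r v

/-- A free node has no label. -/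
def IsFree (D : AltData V) (u : Finset V) : Prop := u ∉ D.plus ∧ u ∉ D.minus

/-- `D.AltPath 𝒩 v true l`: following from `v` parents of alternating type, first the plus-parent
of `v`, one arrives at a root, and `l` lists the nodes visited, including `v` and the root.
With `false` the first arc is the minus-parent of `v`. -/
inductive AltPath (D : AltData V) (𝒩 : Finset (Finset V)) :
    Finset V → Bool → List (Finset V) → Prop
  | root (r : Finset V) (hr : D.IsRoot 𝒩 r) : AltPath D 𝒩 r true [r]
  | plus (v v' : Finset V) (l : List (Finset V)) (hv : v ∈ 𝒩) (hp : v ∈ D.plus)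
      (hr : ¬ D.IsRoot 𝒩 v) (hv' : v' ∈ 𝒩) (h : (D.plusParent v).2 ∈ v')
      (hl : AltPath D 𝒩 v' false l) : AltPath D 𝒩 v true (v :: l)
  | minus (v v' : Finset V) (l : List (Finset V)) (hv : v ∈ 𝒩) (hm : v ∈ D.minus)
      (hv' : v' ∈ 𝒩) (h : (D.minusParent v).2 ∈ v')
      (hl : AltPath D 𝒩 v' true l) : AltPath D 𝒩 v false (v :: l)

/-- `v` belongs to the tree with root `r`. -/
def InTree (D : AltData V) (𝒩 : Finset (Finset V)) (r v : Finset V) : Prop :=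
  ∃ (b : Bool) (l : List (Finset V)), D.AltPath 𝒩 v b l ∧ l.getLast? = some r

/-- Forest of alternating paths in the graph obtained from `H` with node set `𝒩`: `M` is a
matching, roots are purely plus-nodes, every other plus-node has a matched incident edge as its
plus-parent, every minus-node has an unmatched incident edge as its minus-parent, and following
parents in alternating order gives simple paths that end at a root. -/
structure IsForest (D : AltData V) (H : SimpleGraph V) (𝒩 : Finset (Finset V)) : Prop where
  matching : D.IsMatching H 𝒩
  root : ∀ r, D.IsRoot 𝒩 r → r ∈ D.plus ∧ r ∉ D.minus
  plusParent : ∀ u ∈ 𝒩, u ∈ D.plus → ¬ D.IsRoot 𝒩 u →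
    (D.plusParent u).1 ∈ u ∧ (∃ v ∈ 𝒩, v ≠ u ∧ (D.plusParent u).2 ∈ v) ∧
      H.Adj (D.plusParent u).1 (D.plusParent u).2 ∧
      s((D.plusParent u).1, (D.plusParent u).2) ∈ D.M
  minusParent : ∀ u ∈ 𝒩, u ∈ D.minus →
    (D.minusParent u).1 ∈ u ∧ (∃ v ∈ 𝒩, v ≠ u ∧ (D.minusParent u).2 ∈ v) ∧
      H.Adj (D.minusParent u).1 (D.minusParent u).2 ∧
      s((D.minusParent u).1, (D.minusParent u).2) ∉ D.M
  plusPath : ∀ u ∈ 𝒩, u ∈ D.plus → ∃ l, D.AltPath 𝒩 u true l ∧ l.Nodup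
  minusPath : ∀ u ∈ 𝒩, u ∈ D.minus → ∃ l, D.AltPath 𝒩 u false l ∧ l.Nodup

/-- Labels are given to both ends of a matched edge: the mate of a minus-node is a plus-node. -/
def MinusMatched (D : AltData V) (𝒩 : Finset (Finset V)) : Prop :=
  ∀ u ∈ 𝒩, u ∈ D.minus → ∃ v ∈ 𝒩, v ∈ D.plus ∧ D.Mates u v

/-- No node is both a plus- and a minus-node. -/
def NoPlusMinus (D : AltData V) (𝒩 : Finset (Finset V)) : Prop :=
  ∀ u ∈ 𝒩, ¬ (u ∈ D.plus ∧ u ∈ D.minus)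

/-- Some edge of `H` joins `u` and `v`. -/
def Joined (H : SimpleGraph V) (u v : Finset V) : Prop := ∃ a ∈ u, ∃ b ∈ v, H.Adj a b

/-- A plus-node `v` is joined to a free node `x` that is matched to a free node `z`. -/
def CanGrow (D : AltData V) (H : SimpleGraph V) (𝒩 : Finset (Finset V)) : Prop :=
  ∃ v ∈ 𝒩, ∃ x ∈ 𝒩, ∃ z ∈ 𝒩, v ∈ D.plus ∧ Joined H v x ∧ D.Mates x z ∧
    D.IsFree x ∧ D.IsFree z

/-- Plus-nodes of different trees are joined. -/
def CanAugment (D : AltData V) (H : SimpleGraph V) (𝒩 : Finset (Finset V)) : Prop :=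
  ∃ u ∈ 𝒩, ∃ v ∈ 𝒩, u ∈ D.plus ∧ v ∈ D.plus ∧ Joined H u v ∧
    ∃ r r', D.InTree 𝒩 r u ∧ D.InTree 𝒩 r' v ∧ r ≠ r'

/-- Some purely minus-node is a supernode with zero dual variable. -/
def CanExpand (D : AltData V) (𝓑 : Finset (Finset V)) (y : Finset V → ℝ)
    (𝒩 : Finset (Finset V)) : Prop :=
  ∃ v ∈ 𝒩, v ∈ D.minus ∧ v ∉ D.plus ∧ v ∈ 𝓑 ∧ y v = 0

/-- `y'` arises from `y` by the dual update with step `δ r ≥ 0` for the tree with root `r`: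
plus-nodes of that tree go up by `δ r`, minus-nodes go down by `δ r`, all else is kept. -/
def IsDualUpdate (D : AltData V) (𝒩 : Finset (Finset V)) (δ y y' : Finset V → ℝ) : Prop :=
  (∀ r, D.IsRoot 𝒩 r → 0 ≤ δ r) ∧ (∀ r, ¬ D.IsRoot 𝒩 r → δ r = 0) ∧
    (∀ r u, D.InTree 𝒩 r u →
      (u ∈ D.plus → y' u = y u + δ r) ∧ (u ∈ D.minus → y' u = y u - δ r)) ∧
    ∀ S, (∀ r, ¬ D.InTree 𝒩 r S) → y' S = y S

/-- The steps `δ` give a dual update that keeps the dual solution feasible. -/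
def IsFeasibleStep [Fintype V] [DecidableEq V] (D : AltData V) (G : SimpleGraph V)
    (w : Sym2 V → ℝ) (𝒩 : Finset (Finset V)) (y δ : Finset V → ℝ) : Prop :=
  ∃ y', D.IsDualUpdate 𝒩 δ y y' ∧ DualFeasible G w y'

/-- A dual update makes progress: no node is a `±`-node, and there are feasible steps, not all
zero, that have been increased as far as possible. (If there are no feasible steps but zero, or
if feasible steps can be increased forever, there is no such update.) -/
def DualProgress [Fintype V] [DecidableEq V] (D : AltData V) (G : SimpleGraph V)
    (w : Sym2 V → ℝ) (𝒩 : Finset (Finset V)) (y : Finset V → ℝ) : Prop :=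
  D.NoPlusMinus 𝒩 ∧ ∃ δ, D.IsFeasibleStep G w 𝒩 y δ ∧ (∃ r, 0 < δ r) ∧
    ∀ δ', D.IsFeasibleStep G w 𝒩 y δ' → (∀ r, δ r ≤ δ' r) → δ' = δ

end AltData

/-! ### Cherry forests and cherry blossoms -/

/-- The data of a cherry forest: also every `±`-node has a receptacle. -/
structure CherryData (V : Type*) extends AltData V where
  receptacle : Finset V → Finset V

namespace CherryData

variable {V : Type*} [DecidableEq V]

/-- Cherry forest in the graph obtained from `H` with node set `𝒩`: the receptacle of a `±`-node
`u` is a purely plus-node which lies on both alternating paths from `u` to the root, and all nodes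
before it on these paths are `±`-nodes. -/
structure IsCherryForest (D : CherryData V) (H : SimpleGraph V) (𝒩 : Finset (Finset V)) :
    Prop extends D.toAltData.IsForest H 𝒩 where
  receptacle_plus : ∀ u ∈ 𝒩, u ∈ D.plus → u ∈ D.minus →
    D.receptacle u ∈ 𝒩 ∧ D.receptacle u ∈ D.plus ∧ D.receptacle u ∉ D.minus
  receptacle_path : ∀ u ∈ 𝒩, u ∈ D.plus → u ∈ D.minus → ∀ b l, D.AltPath 𝒩 u b l →
    D.receptacle u ∈ l ∧
      ∀ v ∈ l.takeWhile (fun v => v ≠ D.receptacle u), v ∈ D.plus ∧ v ∈ D.minus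

/-- The cherry blossom with receptacle `x`, including `x`. -/
def cherryBlossom (D : CherryData V) (𝒩 : Finset (Finset V)) (x : Finset V) :
    Finset (Finset V) :=
  insert x (𝒩.filter fun v => v ∈ D.plus ∧ v ∈ D.minus ∧ D.receptacle v = x)

/-- The receptacle of the cherry blossom of the plus-node `u`, which may be `u` alone. -/
def base (D : CherryData V) (u : Finset V) : Finset V :=
  if u ∈ D.plus ∧ u ∈ D.minus then D.receptacle u else u

end CherryData

/-- The node obtained by contracting the nodes in `C`. -/
def merge {V : Type*} [DecidableEq V] (C : Finset (Finset V)) : Finset V := C.biUnion id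

/-- The node set after contracting the nodes in `C`. -/
def contract {V : Type*} [DecidableEq V] (𝒩 C : Finset (Finset V)) : Finset (Finset V) :=
  insert (merge C) (𝒩 \ C)

/-! ### Traditional blossoms -/

/-- `c 0, …, c (2k)` with `k ≥ 1` is an odd cycle of distinct nodes of `𝒩`, with edges `e i` of `H`
from `c i` to `c (i + 1)` (cyclically), of which `e 1, e 3, …, e (2k - 1)` are matched and the others
are not: an odd alternating cycle with base `c 0`. -/
structure IsOddCycle {V : Type*} (H : SimpleGraph V) (M : Finset (Sym2 V))
    (𝒩 : Finset (Finset V)) (k : ℕ) (c : Fin (2 * k + 1) → Finset V)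
    (e : Fin (2 * k + 1) → V × V) : Prop where
  pos : 1 ≤ k
  mem : ∀ i, c i ∈ 𝒩
  inj : Function.Injective c
  edge : ∀ i, (e i).1 ∈ c i ∧ (e i).2 ∈ c (i + 1) ∧ H.Adj (e i).1 (e i).2
  alternating : ∀ i, s((e i).1, (e i).2) ∈ M ↔ Odd (i : ℕ)

/-- `𝒩'` arises from `𝒩` by shrinking an odd alternating cycle whose base is the node `x` or
a node into which `x` has been contracted. -/
def OddCycleShrink {V : Type*} [DecidableEq V] (H : SimpleGraph V) (M : Finset (Sym2 V))
    (x : Finset V) (𝒩 𝒩' : Finset (Finset V)) : Prop :=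
  ∃ (k : ℕ) (c : Fin (2 * k + 1) → Finset V) (e : Fin (2 * k + 1) → V × V),
    IsOddCycle H M 𝒩 k c e ∧ x ⊆ c 0 ∧ 𝒩' = contract 𝒩 (Finset.univ.image c)

/-! ### States of the traditional multi-tree algorithm -/

/-- Blossoms, dual variables, matching and alternating forest. -/
structure TradState (V : Type*) extends AltData V where
  blossoms : Finset (Finset V)
  y : Finset V → ℝ

namespace TradState

variable {V : Type*} [Fintype V] [DecidableEq V]

/-- The current nodes. -/
def top (t : TradState V) : Finset (Finset V) := topNodes t.blossoms

/-- The invariants of a traditional multi-tree blossom algorithm: blossoms are nested odd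
alternating cycles of tight edges, the current graph carries a matching and an alternating forest
of tight edges, the dual solution is feasible and supported on nodes. -/
structure IsValid (t : TradState V) (G : SimpleGraph V) (w : Sym2 V → ℝ) : Prop where
  laminar : IsLaminar t.blossoms
  feasible : DualFeasible G w t.y
  support : ∀ S : Finset V, 1 < S.card → S ∉ t.blossoms → t.y S = 0
  cycle : ∀ B ∈ t.blossoms,
    t.IsMatching (tightGraph G w t.y) (children t.blossoms B) ∧
      ∃ (k : ℕ) (c : Fin (2 * k + 1) → Finset V) (e : Fin (2 * k + 1) → V × V),
        IsOddCycle (tightGraph G w t.y) t.M (children t.blossoms B) k c e ∧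
          Finset.univ.image c = children t.blossoms B
  forest : t.IsForest (tightGraph G w t.y) t.top
  alternating : t.NoPlusMinus t.top
  minusMatched : t.MinusMatched t.top

/-- Two plus-nodes of the same tree are joined by a tight edge. -/
def CanShrink (t : TradState V) (H : SimpleGraph V) : Prop :=
  ∃ u ∈ t.top, ∃ v ∈ t.top, u ≠ v ∧ u ∈ t.plus ∧ v ∈ t.plus ∧ AltData.Joined H u v ∧
    ∃ r, t.InTree t.top r u ∧ t.InTree t.top r v

/-- A grow, augment, shrink or expand operation is possible. -/
def PrimalProgress (t : TradState V) (G : SimpleGraph V) (w : Sym2 V → ℝ) : Prop :=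
  t.CanGrow (tightGraph G w t.y) t.top ∨ t.CanAugment (tightGraph G w t.y) t.top ∨
    t.CanShrink (tightGraph G w t.y) ∨ t.CanExpand t.blossoms t.y t.top

/-- Trees exist, and neither a primal nor a dual update makes progress. -/
def IsStuck (t : TradState V) (G : SimpleGraph V) (w : Sym2 V → ℝ) : Prop :=
  (∃ r, t.IsRoot t.top r) ∧ ¬ t.PrimalProgress G w ∧ ¬ t.DualProgress G w t.top t.y

end TradState

/-! ### States of Blossom VI -/

/-- Supernodes, dual variables, matchings and cherry forests (of the current graph and inside
the supernodes). -/
structure CherryState (V : Type*) extends CherryData V where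
  blossoms : Finset (Finset V)
  y : Finset V → ℝ

namespace CherryState

variable {V : Type*} [Fintype V] [DecidableEq V]

/-- The current nodes. -/
def top (s : CherryState V) : Finset (Finset V) := topNodes s.blossoms

/-- The invariants of Blossom VI: a supernode has an odd number of elements, which form a cherry
forest of tight edges with one unmatched node, all other nodes being `±`-nodes; the current graph
carries a cherry forest of tight edges; the dual solution is feasible and supported on nodes. -/
structure IsValid (s : CherryState V) (G : SimpleGraph V) (w : Sym2 V → ℝ) : Prop where
  laminar : IsLaminar s.blossoms
  feasible : DualFeasible G w s.y
  support : ∀ S : Finset V, 1 < S.card → S ∉ s.blossoms → s.y S = 0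
  supernode : ∀ B ∈ s.blossoms,
    Odd (children s.blossoms B).card ∧
      s.IsCherryForest (tightGraph G w s.y) (children s.blossoms B) ∧
      ∃ r, s.IsRoot (children s.blossoms B) r ∧
        ∀ u ∈ children s.blossoms B, u ≠ r → u ∈ s.plus ∧ u ∈ s.minus
  forest : s.IsCherryForest (tightGraph G w s.y) s.top
  minusMatched : s.MinusMatched s.top

/-- Plus-nodes of the same tree but of different cherry blossoms are joined by a tight edge. -/
def CanGrowIn (s : CherryState V) (H : SimpleGraph V) : Prop :=
  ∃ u ∈ s.top, ∃ v ∈ s.top, u ∈ s.plus ∧ v ∈ s.plus ∧ s.base u ≠ s.base v ∧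
    AltData.Joined H u v ∧ ∃ r, s.InTree s.top r u ∧ s.InTree s.top r v

/-- There is a cherry blossom that consists of more than its receptacle. -/
def CanShrink (s : CherryState V) : Prop :=
  ∃ x ∈ s.top, x ∈ s.plus ∧ x ∉ s.minus ∧ s.cherryBlossom s.top x ≠ {x}

/-- A grow-out, grow-in, augment, shrink or expand operation is possible. -/
def PrimalProgress (s : CherryState V) (G : SimpleGraph V) (w : Sym2 V → ℝ) : Prop :=
  s.CanGrow (tightGraph G w s.y) s.top ∨ s.CanGrowIn (tightGraph G w s.y) ∨
    s.CanAugment (tightGraph G w s.y) s.top ∨ s.CanShrink ∨ s.CanExpand s.blossoms s.y s.top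

/-- Trees exist, and neither a primal nor a dual update makes progress. -/
def IsStuck (s : CherryState V) (G : SimpleGraph V) (w : Sym2 V → ℝ) : Prop :=
  (∃ r, s.IsRoot s.top r) ∧ ¬ s.PrimalProgress G w ∧ ¬ s.DualProgress G w s.top s.y

/-- The nodes of the current graph that are not `±`-nodes. Each `±`-node lies in the cherry blossom
of exactly one of them. -/
def pureTop (s : CherryState V) : Finset (Finset V) :=
  s.top.filter fun x => ¬ (x ∈ s.plus ∧ x ∈ s.minus)

/-- The node that `x` becomes when all cherry blossoms are shrunk. -/
def shrunk (s : CherryState V) (x : Finset V) : Finset V := merge (s.cherryBlossom s.top x)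

/-- The traditional state `t` realizes the state that `s` reaches when all its cherry blossoms are
shrunk: same matching, same dual variables, same current nodes with the same labels and parents,
and every supernode of `s` is a blossom of `t`. -/
structure RealizedBy (s : CherryState V) (t : TradState V) : Prop where
  M : t.M = s.M
  y : t.y = s.y
  blossoms : s.blossoms ⊆ t.blossoms
  top : t.top = s.pureTop.image s.shrunk
  plus : ∀ x ∈ s.pureTop, s.shrunk x ∈ t.plus ↔ x ∈ s.plus
  minus : ∀ x ∈ s.pureTop, s.shrunk x ∈ t.minus ↔ x ∈ s.minus
  plusParent : ∀ x ∈ s.pureTop, t.plusParent (s.shrunk x) = s.plusParent x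
  minusParent : ∀ x ∈ s.pureTop, t.minusParent (s.shrunk x) = s.minusParent x

end CherryState

end Blossom

namespace Blossom

/-! ### Laminar families and contraction -/

/-! Part (1). Suppose a part `A` of the cherry blossom of `x` has been contracted that contains `x`
and is joined to the rest of the blossom by no matched edge. Following parents from a node of the
rest, one stays in the blossom until `A` is entered, necessarily by an unmatched edge (`successor`,
`reaches`). Let `v` be the last node before `A`. The plus-path of `v` starts with a matched edge and
also returns to `A` by an unmatched edge; with the unmatched edge from `v` to `A` it closes to an
odd alternating cycle whose base is the contracted node. Shrinking it enlarges `A`, and again no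
matched edge joins `A` to the rest. Starting from `{x}`, this exhausts the blossom (`shrink_rest`).

Part (2). Contracting maximal nodes amounts to inserting their union into the laminar family
(`maxNodes_insert`). So the shrinks of part (1) refine the supernodes and the current graph to
nested traditional blossoms. Neither parent of a `±`-node leaves its cherry blossom, hence shrinking
all cherry blossoms just deletes the `±`-nodes from the alternating paths, and an ordinary
alternating forest remains (`altPath_toTrad`). In a stuck state nothing can be shrunk, so there are
no `±`-nodes, the two current graphs coincide, and a traditional operation would be one of Blossom
VI.

Part (3). If there is a perfect matching, weak duality bounds the sum of the dual variables of all
odd sets (`exists_dual_bound`). In a stuck state a small equal step for all trees is feasible, since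
no dual constraint that is tight gets worse (`exists_feasibleStep`). The changes at minus-nodes and
their mates cancel, so a dual update raises the objective by the sum of its steps (`sum_dualStep`).
Hence the feasible steps form a compact set, and one with largest sum is non-zero and cannot be
increased: a dual update makes progress, a contradiction. -/

theorem IsNodeSet.mono {V : Type*} {𝒩 𝒩' : Finset (Finset V)} (h : IsNodeSet 𝒩') (hs : 𝒩 ⊆ 𝒩') :
    IsNodeSet 𝒩 :=
  ⟨fun u hu => h.1 u (hs hu), fun u hu v hv => h.2 u (hs hu) v (hs hv)⟩

theorem IsNodeSet.eq_of_mem {V : Type*} {𝒩 : Finset (Finset V)} (h : IsNodeSet 𝒩)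
    {u v : Finset V} (hu : u ∈ 𝒩) (hv : v ∈ 𝒩) {a : V} (hau : a ∈ u) (hav : a ∈ v) : u = v := by
  by_contra hne
  exact Finset.disjoint_left.1 (h.2 u hu v hv hne) hau hav

section Merge

variable {V : Type*} [DecidableEq V]

theorem mem_merge {C : Finset (Finset V)} {v : V} : v ∈ merge C ↔ ∃ c ∈ C, v ∈ c := by
  simp [merge]

theorem subset_merge {C : Finset (Finset V)} {c : Finset V} (hc : c ∈ C) : c ⊆ merge C :=
  fun _ hv => mem_merge.2 ⟨c, hc, hv⟩

theorem merge_union (C C' : Finset (Finset V)) : merge (C ∪ C') = merge C ∪ merge C' :=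
  Finset.union_biUnion

theorem merge_singleton (x : Finset V) : merge {x} = x := by simp [merge]

theorem IsNodeSet.ssubset_merge {C : Finset (Finset V)} (h : IsNodeSet C) (hC : 1 < C.card)
    {c : Finset V} (hc : c ∈ C) :
    c ⊂ merge C := by
  refine lt_of_le_of_ne (subset_merge hc) fun heq => ?_
  obtain ⟨d, hd, hdc⟩ := Finset.exists_mem_ne hC c
  obtain ⟨a, ha⟩ := h.1 d hd
  have := subset_merge hd ha
  rw [← heq] at this
  exact Finset.disjoint_left.1 (h.2 d hd c hc hdc) ha this

end Merge

/-! ### Maximal nodes and levels of a laminar family. -/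

section Laminar

variable {V : Type*} [Fintype V] [DecidableEq V] {𝓑 : Finset (Finset V)}

theorem mem_nodes {S : Finset V} : S ∈ nodes 𝓑 ↔ (∃ v, {v} = S) ∨ S ∈ 𝓑 := by
  simp [nodes]

theorem IsLaminar.nonempty_of_mem_nodes (h : IsLaminar 𝓑) {S : Finset V} (hS : S ∈ nodes 𝓑) :
    S.Nonempty := by
  rcases mem_nodes.1 hS with ⟨v, rfl⟩ | hS
  · exact Finset.singleton_nonempty v
  · exact Finset.card_pos.1 (by have := h.1 S hS; omega)

theorem IsLaminar.nested (h : IsLaminar 𝓑) {A B : Finset V} (hA : A ∈ nodes 𝓑)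
    (hB : B ∈ nodes 𝓑) : A ⊆ B ∨ B ⊆ A ∨ Disjoint A B := by
  rcases mem_nodes.1 hA with ⟨v, rfl⟩ | hA'
  · by_cases hv : v ∈ B
    · exact Or.inl (by simpa using hv)
    · exact Or.inr (Or.inr (by simpa using hv))
  · rcases mem_nodes.1 hB with ⟨v, rfl⟩ | hB'
    · by_cases hv : v ∈ A
      · exact Or.inr (Or.inl (by simpa using hv))
      · exact Or.inr (Or.inr (by simpa using hv))
    · exact h.2 A hA' B hB'

open Classical in
/-- The maximal nodes with the property `P`. -/
noncomputable def maxNodes (𝓑 : Finset (Finset V)) (P : Finset V → Prop) : Finset (Finset V) :=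
  (nodes 𝓑).filter fun S => P S ∧ ∀ T ∈ nodes 𝓑, S ⊂ T → ¬ P T

theorem mem_maxNodes {P : Finset V → Prop} {S : Finset V} :
    S ∈ maxNodes 𝓑 P ↔ S ∈ nodes 𝓑 ∧ P S ∧ ∀ T ∈ nodes 𝓑, S ⊂ T → ¬ P T := by
  simp [maxNodes]

/-- With `children_eq_maxNodes`, this allows the current graph and the inside of a supernode to be
treated by the same lemmas. -/
theorem topNodes_eq_maxNodes : topNodes 𝓑 = maxNodes 𝓑 fun _ => True := by
  ext S
  simp [mem_maxNodes, topNodes]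

theorem children_eq_maxNodes (B : Finset V) : children 𝓑 B = maxNodes 𝓑 fun S => S ⊂ B := by
  ext S
  simp [mem_maxNodes, children]

/-- The sets with the property `P` are all sets, or the proper subsets of a node. -/
structure IsLevel (𝓑 : Finset (Finset V)) (P : Finset V → Prop) : Prop where
  down : ∀ S T, S ⊆ T → P T → P S
  -- Needed to compare a merged set with larger nodes: swallowing one member of the level without
  -- belonging to it means swallowing all of them.
  above : ∀ A ∈ nodes 𝓑, ∀ S, S.Nonempty → P S → S ⊆ A → ¬ P A → ∀ S', P S' → S' ⊆ A

theorem isLevel_top : IsLevel 𝓑 fun _ => True :=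
  ⟨fun _ _ _ _ => trivial, fun _ _ _ _ _ _ h => (h trivial).elim⟩

theorem IsLaminar.isLevel_children (h : IsLaminar 𝓑) {B : Finset V} (hB : B ∈ nodes 𝓑) :
    IsLevel 𝓑 fun S => S ⊂ B := by
  refine ⟨fun S T hST hT => lt_of_le_of_lt hST hT, fun A hA S hne hS hSA hAB S' hS' => ?_⟩
  have hBA : B ⊆ A := by
    rcases h.nested hA hB with h1 | h1 | h1
    · rcases eq_or_ssubset_of_subset h1 with h2 | h2
      · exact h2 ▸ subset_rfl
      · exact (hAB h2).elim
    · exact h1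
    · obtain ⟨a, ha⟩ := hne
      exact (Finset.disjoint_left.1 h1 (hSA ha) (hS.1 ha)).elim
  exact hS'.1.trans hBA

theorem IsLaminar.isNodeSet_maxNodes (h : IsLaminar 𝓑) (P : Finset V → Prop) :
    IsNodeSet (maxNodes 𝓑 P) := by
  refine ⟨fun u hu => h.nonempty_of_mem_nodes (mem_maxNodes.1 hu).1, fun u hu v hv huv => ?_⟩
  obtain ⟨hu1, hu2, hu3⟩ := mem_maxNodes.1 hu
  obtain ⟨hv1, hv2, hv3⟩ := mem_maxNodes.1 hv
  rcases h.nested hu1 hv1 with h1 | h1 | h1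
  · exact (hu3 v hv1 (lt_of_le_of_ne h1 huv) hv2).elim
  · exact (hv3 u hu1 (lt_of_le_of_ne h1 huv.symm) hu2).elim
  · exact h1

theorem IsLaminar.isNodeSet_topNodes (h : IsLaminar 𝓑) : IsNodeSet (topNodes 𝓑) := by
  rw [topNodes_eq_maxNodes]; exact h.isNodeSet_maxNodes _

theorem IsLaminar.isNodeSet_children (h : IsLaminar 𝓑) (B : Finset V) :
    IsNodeSet (children 𝓑 B) := by
  rw [children_eq_maxNodes]; exact h.isNodeSet_maxNodes _

theorem exists_maxNodes_superset {P : Finset V → Prop} {S : Finset V} (hS : S ∈ nodes 𝓑)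
    (hP : P S) : ∃ T ∈ maxNodes 𝓑 P, S ⊆ T := by
  classical
  obtain ⟨T, hST, hT⟩ := ((nodes 𝓑).filter P).exists_le_maximal (a := S) (by simp [hS, hP])
  refine ⟨T, mem_maxNodes.2 ?_, hST⟩
  have h1 := hT.prop
  simp only [Finset.mem_filter] at h1
  refine ⟨h1.1, h1.2, fun T' hT' hlt hP' => ?_⟩
  exact absurd (hT.le_of_ge (y := T') (by simp [hT', hP']) hlt.le) (not_le_of_gt hlt)

theorem singleton_mem_nodes (v : V) : {v} ∈ nodes 𝓑 := mem_nodes.2 (Or.inl ⟨v, rfl⟩)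

theorem exists_mem_topNodes (v : V) : ∃ A ∈ topNodes 𝓑, v ∈ A := by
  rw [topNodes_eq_maxNodes]
  obtain ⟨T, hT, hv⟩ := exists_maxNodes_superset (𝓑 := 𝓑) (P := fun _ => True)
    (singleton_mem_nodes v) trivial
  exact ⟨T, hT, by simpa using hv⟩

/-- Vertices are nodes, so every vertex of `B` lies in some element of `B`; `1 < B.card` makes `{v}`
a proper subset. -/
theorem merge_children {B : Finset V} (hB : 1 < B.card) : merge (children 𝓑 B) = B := by
  ext v
  rw [mem_merge]
  constructor
  · rintro ⟨c, hc, hv⟩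
    rw [children_eq_maxNodes, mem_maxNodes] at hc
    exact hc.2.1.1 hv
  · intro hv
    obtain ⟨T, hT, hvT⟩ := exists_maxNodes_superset (𝓑 := 𝓑) (P := fun S => S ⊂ B)
      (singleton_mem_nodes v) (by
        refine lt_of_le_of_ne (by simpa using hv) ?_
        rintro h
        have h2 : B.card = 1 := by
          rw [← h]; exact Finset.card_singleton v
        omega)
    exact ⟨T, by rwa [children_eq_maxNodes], by simpa using hvT⟩

end Laminar

/-! ### Inserting the union of maximal nodes. -/

section Insert

variable {V : Type*} [Fintype V] [DecidableEq V] {𝓑 C : Finset (Finset V)} {P : Finset V → Prop}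

theorem mem_nodes_insert {Y S : Finset V} : S ∈ nodes (insert Y 𝓑) ↔ S = Y ∨ S ∈ nodes 𝓑 := by
  simp only [mem_nodes, Finset.mem_insert]; tauto

/-- A node that meets the union of some maximal nodes lies in one of them or contains one. -/
theorem IsLaminar.meets_merge (h : IsLaminar 𝓑) (hC : C ⊆ nodes 𝓑) {A : Finset V}
    (hA : A ∈ nodes 𝓑) (hAC : ¬ Disjoint A (merge C)) :
    ∃ c ∈ C, A ⊆ c ∨ c ⊂ A := by
  obtain ⟨a, ha, haC⟩ := Finset.not_disjoint_iff.1 hAC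
  obtain ⟨c, hc, hac⟩ := mem_merge.1 haC
  refine ⟨c, hc, ?_⟩
  rcases h.nested hA (hC hc) with h1 | h1 | h1
  · exact Or.inl h1
  · by_cases h2 : A ⊆ c
    · exact Or.inl h2
    · exact Or.inr ⟨h1, h2⟩
  · exact (Finset.disjoint_left.1 h1 ha hac).elim

/-- A node that meets `merge C` is nested with some `c ∈ C`. If it is strictly larger than `c`,
maximality of `c` puts it outside the level, and then it contains every member of the level, in
particular `merge C`. -/
theorem IsLaminar.compare_merge (h : IsLaminar 𝓑) (hP : IsLevel 𝓑 P) (hC : C ⊆ maxNodes 𝓑 P)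
    (hY : P (merge C)) {A : Finset V} (hA : A ∈ nodes 𝓑) :
    (∃ c ∈ C, A ⊆ c) ∨ (merge C ⊆ A ∧ ¬ P A) ∨ Disjoint A (merge C) := by
  by_cases hd : Disjoint A (merge C)
  · exact Or.inr (Or.inr hd)
  obtain ⟨c, hc, h1 | h1⟩ :=
    h.meets_merge (fun c hc => (mem_maxNodes.1 (hC hc)).1) hA hd
  · exact Or.inl ⟨c, hc, h1⟩
  · obtain ⟨hc1, hc2, hc3⟩ := mem_maxNodes.1 (hC hc)
    have hnP := hc3 A hA h1
    exact Or.inr (Or.inl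
      ⟨hP.above A hA c (h.nonempty_of_mem_nodes hc1) hc2 h1.1 hnP _ hY, hnP⟩)

theorem IsLaminar.insert_merge (h : IsLaminar 𝓑) (hP : IsLevel 𝓑 P) (hC : C ⊆ maxNodes 𝓑 P)
    (hY : P (merge C)) (hcard : 1 < C.card) : IsLaminar (insert (merge C) 𝓑) := by
  have hN : IsNodeSet C := (h.isNodeSet_maxNodes P).mono hC
  have key : ∀ A ∈ 𝓑, A ⊆ merge C ∨ merge C ⊆ A ∨ Disjoint A (merge C) := by
    intro A hA
    rcases h.compare_merge hP hC hY (mem_nodes.2 (Or.inr hA)) with ⟨c, hc, h1⟩ | h1 | h1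
    · exact Or.inl (h1.trans (subset_merge hc))
    · exact Or.inr (Or.inl h1.1)
    · exact Or.inr (Or.inr h1)
  refine ⟨fun B hB => ?_, fun A hA B hB => ?_⟩
  · rcases Finset.mem_insert.1 hB with rfl | hB
    · obtain ⟨c, hc⟩ := Finset.card_pos.1 (by omega : 0 < C.card)
      have h1 := Finset.card_lt_card (hN.ssubset_merge hcard hc)
      have h2 := Finset.card_pos.2 (hN.1 c hc)
      omega
    · exact h.1 B hB
  · rcases Finset.mem_insert.1 hA with rfl | hA <;> rcases Finset.mem_insert.1 hB with rfl | hB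
    · exact Or.inl subset_rfl
    · rcases key B hB with h1 | h1 | h1
      · exact Or.inr (Or.inl h1)
      · exact Or.inl h1
      · exact Or.inr (Or.inr h1.symm)
    · exact key A hA
    · exact h.2 A hA B hB

/-- The link between the two views of a shrink: contraction of the graph at a level, and enlargement
of the laminar family. -/
theorem IsLaminar.maxNodes_insert (h : IsLaminar 𝓑) (hC : C ⊆ maxNodes 𝓑 P)
    (hY : P (merge C)) (hcard : 1 < C.card) :
    maxNodes (insert (merge C) 𝓑) P = contract (maxNodes 𝓑 P) C := by
  have hN : IsNodeSet C := (h.isNodeSet_maxNodes P).mono hC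
  obtain ⟨c₀, hc₀⟩ := Finset.card_pos.1 (by omega : 0 < C.card)
  ext S
  simp only [contract, Finset.mem_insert, Finset.mem_sdiff]
  rw [mem_maxNodes, mem_nodes_insert]
  constructor
  · rintro ⟨rfl | hS, hPS, hmax⟩
    · exact Or.inl rfl
    · refine Or.inr ⟨mem_maxNodes.2
        ⟨hS, hPS, fun T hT => hmax T (mem_nodes_insert.2 (Or.inr hT))⟩, fun hSC => ?_⟩
      exact hmax _ (mem_nodes_insert.2 (Or.inl rfl)) (hN.ssubset_merge hcard hSC) hY
  · rintro (rfl | ⟨hS, hSC⟩)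
    · refine ⟨Or.inl rfl, hY, fun T hT hlt hPT => ?_⟩
      rcases mem_nodes_insert.1 hT with rfl | hT
      · exact lt_irrefl _ hlt
      · exact (mem_maxNodes.1 (hC hc₀)).2.2 T hT (lt_of_le_of_lt (subset_merge hc₀) hlt) hPT
    · obtain ⟨hS1, hS2, hS3⟩ := mem_maxNodes.1 hS
      refine ⟨Or.inr hS1, hS2, fun T hT hlt hPT => ?_⟩
      rcases mem_nodes_insert.1 hT with rfl | hT
      · obtain ⟨a, ha⟩ := h.nonempty_of_mem_nodes hS1
        obtain ⟨c, hc, hac⟩ := mem_merge.1 (hlt.1 ha)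
        refine Finset.disjoint_left.1 ((h.isNodeSet_maxNodes P).2 S hS c (hC hc) ?_) ha hac
        rintro rfl
        exact hSC hc
      · exact hS3 T hT hlt hPT

/-- By `compare_merge`, any node outside `C` is strictly below some `c ∈ C`, above the merged set,
or disjoint from it. -/
theorem IsLaminar.children_insert_self (h : IsLaminar 𝓑) (hP : IsLevel 𝓑 P)
    (hC : C ⊆ maxNodes 𝓑 P) (hY : P (merge C)) (hcard : 1 < C.card) :
    children (insert (merge C) 𝓑) (merge C) = C := by
  have hN : IsNodeSet C := (h.isNodeSet_maxNodes P).mono hC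
  ext S
  rw [children_eq_maxNodes, mem_maxNodes, mem_nodes_insert]
  constructor
  · rintro ⟨hS | hS, hlt, hmax⟩
    · exact (lt_irrefl _ (hS ▸ hlt)).elim
    · rcases h.compare_merge hP hC hY hS with ⟨c, hc, h1⟩ | ⟨h1, -⟩ | h1
      · rcases eq_or_ssubset_of_subset h1 with rfl | h2
        · exact hc
        · exact (hmax c (mem_nodes_insert.2 (Or.inr (mem_maxNodes.1 (hC hc)).1)) h2
            (hN.ssubset_merge hcard hc)).elim
      · exact (not_lt_of_ge h1 hlt).elim
      · obtain ⟨a, ha⟩ := h.nonempty_of_mem_nodes hS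
        exact (Finset.disjoint_left.1 h1 ha (hlt.1 ha)).elim
  · intro hS
    obtain ⟨hS1, hS2, hS3⟩ := mem_maxNodes.1 (hC hS)
    refine ⟨Or.inr hS1, hN.ssubset_merge hcard hS, fun T hT hlt hTY => ?_⟩
    rcases mem_nodes_insert.1 hT with rfl | hT
    · exact lt_irrefl _ hTY
    · exact hS3 T hT hlt (hP.down _ _ hTY.1 hY)

/-- Inserting a set does not change the maximal nodes of a level where it is not maximal. -/
theorem maxNodes_insert_of_not_maximal {Y : Finset V} {Q : Finset V → Prop}
    (hQ : Q Y → ∃ B ∈ nodes 𝓑, Y ⊂ B ∧ Q B) :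
    maxNodes (insert Y 𝓑) Q = maxNodes 𝓑 Q := by
  ext S
  rw [mem_maxNodes, mem_maxNodes, mem_nodes_insert]
  constructor
  · rintro ⟨rfl | hS, hQS, hmax⟩
    · obtain ⟨B, hB, hlt, hQB⟩ := hQ hQS
      exact (hmax B (mem_nodes_insert.2 (Or.inr hB)) hlt hQB).elim
    · exact ⟨hS, hQS, fun T hT => hmax T (mem_nodes_insert.2 (Or.inr hT))⟩
  · rintro ⟨hS, hQS, hmax⟩
    refine ⟨Or.inr hS, hQS, fun T hT hlt hQT => ?_⟩
    rcases mem_nodes_insert.1 hT with rfl | hT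
    · obtain ⟨B, hB, hlt', hQB⟩ := hQ hQT
      exact hmax B hB (hlt.trans hlt') hQB
    · exact hmax T hT hlt hQT

/-- A node that properly contains the merged set lies above the level. -/
theorem IsLaminar.not_of_merge_ssubset (hC : C ⊆ maxNodes 𝓑 P) (hcard : 1 < C.card)
    {A : Finset V} (hA : A ∈ nodes 𝓑) (hlt : merge C ⊂ A) : ¬ P A := by
  obtain ⟨c₀, hc₀⟩ := Finset.card_pos.1 (by omega : 0 < C.card)
  exact (mem_maxNodes.1 (hC hc₀)).2.2 A hA (lt_of_le_of_lt (subset_merge hc₀) hlt)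

end Insert

end Blossom

namespace Blossom

/-! ### Alternating paths -/

namespace AltData

variable {V : Type*} {D : AltData V} {H : SimpleGraph V} {𝒩 : Finset (Finset V)}

theorem Mates.symm {u v : Finset V} (h : D.Mates u v) : D.Mates v u := by
  obtain ⟨hne, a, ha, b, hb, hM⟩ := h
  exact ⟨hne.symm, b, hb, a, ha, by rwa [Sym2.eq_swap]⟩

theorem IsMatching.mates_unique (h : D.IsMatching H 𝒩) (hN : IsNodeSet 𝒩) {u v v' : Finset V}
    (hu : u ∈ 𝒩) (hv : v ∈ 𝒩) (hv' : v' ∈ 𝒩) (h1 : D.Mates u v) (h2 : D.Mates u v') : v = v' := by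
  obtain ⟨hne, a, ha, b, hb, hM⟩ := h1
  obtain ⟨hne', a', ha', b', hb', hM'⟩ := h2
  obtain ⟨-, rfl⟩ := h.2 u hu v hv v' hv' hne hne' a ha b hb a' ha' b' hb' hM hM'
  exact hN.eq_of_mem hv hv' hb hb'

theorem IsMatching.mono {𝒩' : Finset (Finset V)} (h : D.IsMatching H 𝒩) (hs : 𝒩' ⊆ 𝒩) :
    D.IsMatching H 𝒩' :=
  ⟨fun u hu v hv => h.1 u (hs hu) v (hs hv),
    fun u hu v hv v' hv' => h.2 u (hs hu) v (hs hv) v' (hs hv')⟩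

theorem AltPath.mem {v : Finset V} {b : Bool} {l : List (Finset V)} (h : D.AltPath 𝒩 v b l) :
    v ∈ 𝒩 := by
  cases h with
  | root _ hr => exact hr.1
  | plus _ _ _ hv => exact hv
  | minus _ _ _ hv => exact hv

theorem AltPath.exists_cons {v : Finset V} {b : Bool} {l : List (Finset V)}
    (h : D.AltPath 𝒩 v b l) : ∃ l', l = v :: l' := by
  cases h <;> exact ⟨_, rfl⟩

theorem IsForest.label_true (hF : D.IsForest H 𝒩) {v : Finset V} {l : List (Finset V)}
    (h : D.AltPath 𝒩 v true l) : v ∈ D.plus := by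
  cases h with
  | root _ hr => exact (hF.root v hr).1
  | plus _ _ _ _ hp => exact hp

theorem AltPath.label_false {v : Finset V} {l : List (Finset V)}
    (h : D.AltPath 𝒩 v false l) : v ∈ D.minus := by
  cases h with
  | minus _ _ _ _ hm => exact hm

theorem IsForest.not_isRoot_of_minus (hF : D.IsForest H 𝒩) {v : Finset V} (hv : v ∈ D.minus) :
    ¬ D.IsRoot 𝒩 v := fun hr => (hF.root v hr).2 hv

/-- The plus-parent of a node that is no root leads to its mate. -/
theorem IsForest.mates_plusParent (hF : D.IsForest H 𝒩) (hN : IsNodeSet 𝒩) {v v' : Finset V}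
    (hv : v ∈ 𝒩) (hp : v ∈ D.plus) (hr : ¬ D.IsRoot 𝒩 v) (hv' : v' ∈ 𝒩)
    (h : (D.plusParent v).2 ∈ v') : D.Mates v v' := by
  obtain ⟨h1, ⟨z, hz, hzv, hz2⟩, -, hM⟩ := hF.plusParent v hv hp hr
  obtain rfl := hN.eq_of_mem hz hv' hz2 h
  exact ⟨hzv.symm, _, h1, _, h, hM⟩

/-- The mate of a plus-node continues its path, hence is a minus-node. -/
theorem IsForest.minus_of_mates_plus (hF : D.IsForest H 𝒩) (hN : IsNodeSet 𝒩) {v v' : Finset V}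
    (hv : v ∈ 𝒩) (hp : v ∈ D.plus) (hv' : v' ∈ 𝒩) (h : D.Mates v v') :
    (D.plusParent v).2 ∈ v' ∧ ∃ l, D.AltPath 𝒩 v' false l := by
  obtain ⟨l, hl, -⟩ := hF.plusPath v hv hp
  cases hl with
  | root _ hr => exact (hr.2 v' hv' h).elim
  | plus _ z l _ _ hr hz hz2 hl =>
    obtain rfl := hF.matching.mates_unique hN hv hz hv' (hF.mates_plusParent hN hv hp hr hz hz2) h
    exact ⟨hz2, l, hl⟩

/-- Nodes are disjoint, so a parent arc determines the node it leads to, and the type of the next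
parent is forced. -/
theorem AltPath.deterministic (hN : IsNodeSet 𝒩) {v : Finset V} {b : Bool}
    {l l' : List (Finset V)} (h : D.AltPath 𝒩 v b l) (h' : D.AltPath 𝒩 v b l') : l = l' := by
  induction h generalizing l' with
  | root r hr =>
    cases h' with
    | root => rfl
    | plus _ _ _ _ _ hr' => exact (hr' hr).elim
  | plus v z l hv hp hr hz hz2 hl ih =>
    cases h' with
    | root _ hr' => exact (hr hr').elim
    | plus _ z' l' _ _ _ hz' hz2' hl' =>
      obtain rfl := hN.eq_of_mem hz hz' hz2 hz2'
      rw [ih hl']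
  | minus v z l hv hm hz hz2 hl ih =>
    cases h' with
    | minus _ z' l' _ _ hz' hz2' hl' =>
      obtain rfl := hN.eq_of_mem hz hz' hz2 hz2'
      rw [ih hl']

end AltData

/-- The first element of a list without the property `p` is unique. -/
theorem eq_of_first_not {α : Type*} [DecidableEq α] {p : α → Prop} {l : List α} {r r' : α}
    (hr : ¬ p r) (hr' : ¬ p r') (hm : r ∈ l) (hm' : r' ∈ l)
    (h : ∀ v ∈ l.takeWhile (fun v => v ≠ r), p v)
    (h' : ∀ v ∈ l.takeWhile (fun v => v ≠ r'), p v) : r = r' := by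
  induction l with
  | nil => simp at hm
  | cons a l ih =>
    by_cases h1 : a = r
    · by_cases h2 : a = r'
      · exact h1.symm.trans h2
      · refine (hr (h1 ▸ h' a ?_)).elim
        simp [h2]
    · by_cases h2 : a = r'
      · refine (hr' (h2 ▸ h a ?_)).elim
        simp [h1]
      · refine ih ?_ ?_ ?_ ?_
        · rcases List.mem_cons.1 hm with h3 | h3
          · exact (h1 h3.symm).elim
          · exact h3
        · rcases List.mem_cons.1 hm' with h3 | h3
          · exact (h2 h3.symm).elim
          · exact h3
        · intro v hv
          refine h v ?_
          rw [List.takeWhile_cons_of_pos (by simpa using h1)]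
          exact List.mem_cons_of_mem _ hv
        · intro v hv
          refine h' v ?_
          rw [List.takeWhile_cons_of_pos (by simpa using h2)]
          exact List.mem_cons_of_mem _ hv

namespace CherryData

open AltData

/-! ### Alternating paths that enter a given set of nodes. -/

section Reaches

variable {V : Type*} {D : CherryData V} {H : SimpleGraph V} {A : Finset (Finset V)}

/-- An alternating path whose nodes lie in `R` and on the list `l` leads from `v` to a node of `A`,
which it enters by an unmatched edge; its first edge is matched if and only if `b` is true. -/
def Reaches (D : CherryData V) (H : SimpleGraph V) (R A : Finset (Finset V)) (v : Finset V)
    (b : Bool) (l : List (Finset V)) : Prop :=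
  ∃ (n : ℕ) (p : ℕ → Finset V) (q : ℕ → V × V), 1 ≤ n ∧ p 0 = v ∧
    (∀ i < n, p i ∈ R ∧ p i ∈ l) ∧ p n ∈ A ∧
    (∀ i < n, ∀ j < n, p i = p j → i = j) ∧
    (∀ i < n, (q i).1 ∈ p i ∧ (q i).2 ∈ p (i + 1) ∧ H.Adj (q i).1 (q i).2 ∧
      (s((q i).1, (q i).2) ∈ D.M ↔ (Even i ↔ b = true))) ∧ (Even n ↔ b = true)

/-- Prepending an arc shifts the indices by one, which exchanges matched and unmatched positions;
hence the type `!b`. The list in `Reaches` is carried along for this step: `v ∉ l` keeps the path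
simple. -/
theorem Reaches.cons {R : Finset (Finset V)} {v v' : Finset V} {b : Bool}
    {l : List (Finset V)} {a : V × V} (h : D.Reaches H R A v' (!b) l) (hv : v ∈ R)
    (ha1 : a.1 ∈ v) (ha2 : a.2 ∈ v') (hadj : H.Adj a.1 a.2)
    (haM : s(a.1, a.2) ∈ D.M ↔ b = true) (hvl : v ∉ l) : D.Reaches H R A v b (v :: l) := by
  obtain ⟨n, p, q, hn, hp0, hpm, hpA, hinj, hq, hpar⟩ := h
  refine ⟨n + 1, fun i => Nat.casesOn i v p, fun i => Nat.casesOn i a q, by omega, rfl,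
    ?_, hpA, ?_, ?_, ?_⟩
  · rintro (_ | i) hi
    · exact ⟨hv, by simp⟩
    · have := hpm i (by omega)
      exact ⟨this.1, List.mem_cons_of_mem _ this.2⟩
  · rintro (_ | i) hi (_ | j) hj hij
    · rfl
    · exact (hvl (show v ∈ l from (show v = p j from hij) ▸ (hpm j (by omega)).2)).elim
    · exact (hvl (show v ∈ l from (show p i = v from hij) ▸ (hpm i (by omega)).2)).elim
    · rw [hinj i (by omega) j (by omega) hij]
  · rintro (_ | i) hi
    · refine ⟨ha1, ?_, hadj, by simpa using haM⟩
      show a.2 ∈ p 0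
      rwa [hp0]
    · obtain ⟨h1, h2, h3, h4⟩ := hq i (by omega)
      refine ⟨h1, h2, h3, h4.trans ?_⟩
      rw [Nat.even_add_one]
      cases b <;> simp
  · rw [Nat.even_add_one, hpar]
    cases b <;> simp

end Reaches

variable {V : Type*} [DecidableEq V] {D : CherryData V} {H : SimpleGraph V}
  {𝒩 : Finset (Finset V)}

theorem mem_cherryBlossom {x v : Finset V} : v ∈ D.cherryBlossom 𝒩 x ↔
    v = x ∨ v ∈ 𝒩 ∧ v ∈ D.plus ∧ v ∈ D.minus ∧ D.receptacle v = x := by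
  simp [cherryBlossom]

/-- The successor of a `±`-node on an alternating path is its receptacle or a `±`-node with the
same receptacle. -/
theorem IsCherryForest.successor (hF : D.IsCherryForest H 𝒩) {v v' : Finset V} {b b' : Bool}
    {l : List (Finset V)} (hp : v ∈ D.plus) (hm : v ∈ D.minus)
    (h : D.AltPath 𝒩 v b (v :: l)) (hl : D.AltPath 𝒩 v' b' l) :
    v' = D.receptacle v ∨
      v' ∈ D.plus ∧ v' ∈ D.minus ∧ D.receptacle v' = D.receptacle v := by
  obtain ⟨h1, h2⟩ := hF.receptacle_path v h.mem hp hm b _ h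
  obtain ⟨-, -, hrm⟩ := hF.receptacle_plus v h.mem hp hm
  have hne : v ≠ D.receptacle v := fun h3 => hrm (h3 ▸ hm)
  have hmem : D.receptacle v ∈ l := by
    rcases List.mem_cons.1 h1 with h3 | h3
    · exact (hne h3.symm).elim
    · exact h3
  have hall : ∀ u ∈ l.takeWhile (fun u => u ≠ D.receptacle v), u ∈ D.plus ∧ u ∈ D.minus := by
    intro u hu
    refine h2 u ?_
    rw [List.takeWhile_cons_of_pos (by simpa using hne)]
    exact List.mem_cons_of_mem _ hu
  by_cases hv' : v' = D.receptacle v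
  · exact Or.inl hv'
  · obtain ⟨l', rfl⟩ := hl.exists_cons
    obtain ⟨hp', hm'⟩ := hall v' (by simp [hv'])
    obtain ⟨-, -, hrm'⟩ := hF.receptacle_plus v' hl.mem hp' hm'
    obtain ⟨h4, h5⟩ := hF.receptacle_path v' hl.mem hp' hm' b' _ hl
    exact Or.inr ⟨hp', hm', eq_of_first_not (p := fun u => u ∈ D.plus ∧ u ∈ D.minus)
      (fun h => hrm' h.2) (fun h => hrm h.2) h4 hmem h5 hall⟩

/-- The mate of a `±`-node is a `±`-node with the same receptacle. -/
theorem IsCherryForest.mate (hF : D.IsCherryForest H 𝒩) (hN : IsNodeSet 𝒩) {v v' : Finset V}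
    (hv : v ∈ 𝒩) (hp : v ∈ D.plus) (hm : v ∈ D.minus) (hv' : v' ∈ 𝒩) (h : D.Mates v v') :
    v' ∈ D.plus ∧ v' ∈ D.minus ∧ D.receptacle v' = D.receptacle v := by
  obtain ⟨h2, l, hl⟩ := hF.minus_of_mates_plus hN hv hp hv' h
  rcases hF.successor hp hm
    (AltPath.plus v v' l hv hp (hF.not_isRoot_of_minus hm) hv' h2 hl) hl with h3 | h3
  · exact ((hF.receptacle_plus v hv hp hm).2.2 (h3 ▸ hl.label_false)).elim
  · exact h3

/-- The mate of a node that is no `±`-node is no `±`-node. -/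
theorem IsCherryForest.pure_of_mates (hF : D.IsCherryForest H 𝒩) (hN : IsNodeSet 𝒩)
    {v v' : Finset V} (hv : v ∈ 𝒩) (h : ¬ (v ∈ D.plus ∧ v ∈ D.minus)) (hv' : v' ∈ 𝒩)
    (hM : D.Mates v v') : ¬ (v' ∈ D.plus ∧ v' ∈ D.minus) := fun h' => by
  obtain ⟨h1, h2, -⟩ := hF.mate hN hv' h'.1 h'.2 hv hM.symm
  exact h ⟨h1, h2⟩

variable {x : Finset V} {A : Finset (Finset V)}

/-- From a node of a cherry blossom outside a set `A` that contains the receptacle and is closed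
under mates, an alternating path leads to `A`. -/
theorem IsCherryForest.reaches (hF : D.IsCherryForest H 𝒩) (hN : IsNodeSet 𝒩)
    (hxA : x ∈ A)
    (hA : ∀ u ∈ D.cherryBlossom 𝒩 x \ A, ∀ v ∈ 𝒩, D.Mates u v → v ∉ A)
    {v : Finset V} {b : Bool} {l : List (Finset V)} (h : D.AltPath 𝒩 v b l) (hl : l.Nodup)
    (hv : v ∈ D.cherryBlossom 𝒩 x \ A) : D.Reaches H (D.cherryBlossom 𝒩 x \ A) A v b l := by
  have pm : ∀ {v : Finset V}, v ∈ D.cherryBlossom 𝒩 x \ A →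
      v ∈ D.plus ∧ v ∈ D.minus ∧ D.receptacle v = x := by
    intro v hv
    obtain ⟨h1, h2⟩ := Finset.mem_sdiff.1 hv
    rcases mem_cherryBlossom.1 h1 with rfl | h3
    · exact (h2 hxA).elim
    · exact h3.2
  induction h with
  -- A root has no minus label, whereas every blossom node outside `A` is a `±`-node.
  | root r hr => exact ((hF.root r hr).2 (pm hv).2.1).elim
  | plus v v' l hv1 hp hr hv' h2 hl' ih =>
    obtain ⟨-, hm, hrec⟩ := pm hv
    have hmate := hF.mates_plusParent hN hv1 hp hr hv' h2
    obtain ⟨hp', hm', hrec'⟩ := hF.mate hN hv1 hp hm hv' hmate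
    obtain ⟨e1, -, e3, e4⟩ := hF.plusParent v hv1 hp hr
    obtain ⟨hvl, hlnd⟩ := List.nodup_cons.1 hl
    -- By `hA` a matched edge never enters `A`, so the path goes on.
    refine Reaches.cons (ih hlnd ?_) hv e1 h2 e3 (by simpa using e4) hvl
    exact Finset.mem_sdiff.2
      ⟨mem_cherryBlossom.2 (Or.inr ⟨hv', hp', hm', hrec'.trans hrec⟩), hA v hv v' hv' hmate⟩
  | minus v v' l hv1 hm hv' h2 hl' ih =>
    obtain ⟨hp, -, hrec⟩ := pm hv
    obtain ⟨e1, -, e3, e4⟩ := hF.minusParent v hv1 hm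
    obtain ⟨hvl, hlnd⟩ := List.nodup_cons.1 hl
    -- The path stops at its first node in `A`, entered along a minus-parent and thus along an
    -- unmatched edge.
    by_cases hv'A : v' ∈ A
    · refine ⟨1, fun i => if i = 0 then v else v', fun _ => D.minusParent v, le_rfl, rfl, ?_,
        by simpa using hv'A, ?_, ?_, by simp⟩
      · intro i hi
        obtain rfl : i = 0 := by omega
        exact ⟨hv, by simp⟩
      · intro i hi j hj _
        omega
      · intro i hi
        obtain rfl : i = 0 := by omega
        exact ⟨e1, by simpa using h2, e3, by simpa using e4⟩
    · refine Reaches.cons (ih hlnd ?_) hv e1 h2 e3 (by simpa using e4) hvl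
      refine Finset.mem_sdiff.2 ⟨mem_cherryBlossom.2 ?_, hv'A⟩
      rcases hF.successor hp hm (AltPath.minus v v' l hv1 hm hv' h2 hl') hl' with h3 | h3
      · exact (hv'A (by rw [h3, hrec]; exact hxA)).elim
      · exact Or.inr ⟨hv', h3.1, h3.2.1, h3.2.2.trans hrec⟩

end CherryData

end Blossom

namespace Blossom

/-! ### Shrinking cherry blossoms by odd alternating cycles -/

/-- An odd cycle given by nodes and edges indexed by natural numbers. -/
theorem isOddCycle_of_nat {V : Type*} {H : SimpleGraph V} {M : Finset (Sym2 V)}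
    {𝒩 : Finset (Finset V)} {k : ℕ} (hk : 1 ≤ k) (c : ℕ → Finset V) (e : ℕ → V × V)
    (hmem : ∀ i < 2 * k + 1, c i ∈ 𝒩)
    (hinj : ∀ i < 2 * k + 1, ∀ j < 2 * k + 1, c i = c j → i = j)
    (he : ∀ i < 2 * k + 1, (e i).1 ∈ c i ∧ H.Adj (e i).1 (e i).2 ∧
      (s((e i).1, (e i).2) ∈ M ↔ Odd i))
    (hnext : ∀ i < 2 * k, (e i).2 ∈ c (i + 1)) (hlast : (e (2 * k)).2 ∈ c 0) :
    IsOddCycle H M 𝒩 k (fun i => c i) (fun i => e i) where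
  pos := hk
  mem i := hmem i i.2
  inj i j hij := Fin.ext (hinj i i.2 j j.2 hij)
  edge i := by
    refine ⟨(he i i.2).1, ?_, (he i i.2).2.1⟩
    show (e i).2 ∈ c ((i + 1 : Fin (2 * k + 1)) : ℕ)
    rw [Fin.val_add_one]
    split_ifs with h
    · rw [h]; exact hlast
    · refine hnext i ?_
      have h1 := i.2
      have h2 : (i : ℕ) ≠ 2 * k := fun h' => h (Fin.ext h')
      omega
  alternating i := (he i i.2).2.2

variable {V : Type*} [DecidableEq V] {D : CherryData V} {H : SimpleGraph V}
  {𝒩 : Finset (Finset V)} {x : Finset V}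

theorem OddCycleShrink.mono {M : Finset (Sym2 V)} {x y : Finset V} {𝒩 𝒩' : Finset (Finset V)}
    (h : OddCycleShrink H M x 𝒩 𝒩') (hy : y ⊆ x) : OddCycleShrink H M y 𝒩 𝒩' := by
  obtain ⟨k, c, e, h1, h2, h3⟩ := h
  exact ⟨k, c, e, h1, hy.trans h2, h3⟩

/-- Odd cycles can be shrunk in the presence of further nodes. -/
theorem reflTransGen_oddCycleShrink_union {M : Finset (Sym2 V)} {𝒩 𝒩' 𝒪 : Finset (Finset V)}
    (h : Relation.ReflTransGen (OddCycleShrink H M x) 𝒩 𝒩') (hne : ∀ u ∈ 𝒩, u.Nonempty)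
    (hd : ∀ u ∈ 𝒩, ∀ o ∈ 𝒪, Disjoint o u) :
    Relation.ReflTransGen (OddCycleShrink H M x) (𝒪 ∪ 𝒩) (𝒪 ∪ 𝒩') := by
  suffices H' : Relation.ReflTransGen (OddCycleShrink H M x) (𝒪 ∪ 𝒩) (𝒪 ∪ 𝒩') ∧
      (∀ u ∈ 𝒩', u.Nonempty) ∧ ∀ u ∈ 𝒩', ∀ o ∈ 𝒪, Disjoint o u from H'.1
  induction h with
  | refl => exact ⟨.refl, hne, hd⟩
  | tail _ hstep ih =>
    obtain ⟨ih1, ih2, ih3⟩ := ih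
    obtain ⟨k, c, e, hc, hx, rfl⟩ := hstep
    refine ⟨ih1.tail ⟨k, c, e, ?_, hx, ?_⟩, ?_, ?_⟩
    · exact ⟨hc.pos, fun i => Finset.mem_union_right _ (hc.mem i), hc.inj, hc.edge,
        hc.alternating⟩
    · have : 𝒪 \ Finset.univ.image c = 𝒪 := by
        rw [Finset.sdiff_eq_self_iff_disjoint, Finset.disjoint_left]
        intro o ho hoc
        obtain ⟨i, -, rfl⟩ := Finset.mem_image.1 hoc
        obtain ⟨a, ha⟩ := ih2 _ (hc.mem i)
        exact Finset.disjoint_left.1 (ih3 _ (hc.mem i) _ ho) ha ha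
      rw [contract, contract, Finset.union_sdiff_distrib, this, Finset.union_insert]
    · intro u hu
      rcases Finset.mem_insert.1 hu with rfl | hu
      · obtain ⟨a, ha⟩ := ih2 _ (hc.mem 0)
        exact ⟨a, mem_merge.2 ⟨_, Finset.mem_image_of_mem c (Finset.mem_univ 0), ha⟩⟩
      · exact ih2 u (Finset.mem_sdiff.1 hu).1
    · intro u hu o ho
      rcases Finset.mem_insert.1 hu with rfl | hu
      · rw [merge, Finset.disjoint_biUnion_right]
        intro v hv
        obtain ⟨i, -, rfl⟩ := Finset.mem_image.1 hv
        exact ih3 _ (hc.mem i) o ho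
      · exact ih3 u (Finset.mem_sdiff.1 hu).1 o ho

/-- Contracting in two stages agrees with contracting at once; `hA` prevents the node `merge A` from
being confused with one of the remaining nodes. -/
theorem contract_insert_merge {A B C : Finset (Finset V)} (hA : merge A ∉ C \ A) :
    contract (insert (merge A) (C \ A)) (insert (merge A) B) =
      insert (merge (A ∪ B)) (C \ (A ∪ B)) := by
  have h1 : merge (insert (merge A) B) = merge (A ∪ B) := by
    rw [merge_union, Finset.insert_eq, merge_union, merge_singleton]
  rw [contract, h1]
  congr 1
  ext u
  simp only [Finset.mem_sdiff, Finset.mem_insert, Finset.mem_union, not_or]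
  constructor
  · rintro ⟨h2 | h2, h3, h4⟩
    · exact (h3 h2).elim
    · exact ⟨h2.1, h2.2, h4⟩
  · rintro ⟨h2, h3, h4⟩
    refine ⟨Or.inr ⟨h2, h3⟩, ?_, h4⟩
    rintro rfl
    exact hA (Finset.mem_sdiff.2 ⟨h2, h3⟩)

namespace CherryData

open AltData

theorem IsCherryForest.cherryBlossom_subset (hx : x ∈ 𝒩) :
    D.cherryBlossom 𝒩 x ⊆ 𝒩 := by
  intro v hv
  rcases mem_cherryBlossom.1 hv with rfl | h
  · exact hx
  · exact h.1

/-- If a part `A` of a cherry blossom has been contracted that contains the receptacle and is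
closed under mates, the rest can be shrunk as well. -/
theorem IsCherryForest.shrink_rest (hF : D.IsCherryForest H 𝒩) (hN : IsNodeSet 𝒩) (hx : x ∈ 𝒩)
    (n : ℕ) (A : Finset (Finset V)) (hn : (D.cherryBlossom 𝒩 x \ A).card ≤ n) (hxA : x ∈ A)
    (hAC : A ⊆ D.cherryBlossom 𝒩 x)
    (hA : ∀ u ∈ D.cherryBlossom 𝒩 x \ A, ∀ v ∈ 𝒩, D.Mates u v → v ∉ A) :
    Relation.ReflTransGen (OddCycleShrink H D.M x)
      (insert (merge A) (D.cherryBlossom 𝒩 x \ A)) {merge (D.cherryBlossom 𝒩 x)} := by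
  induction n generalizing A with
  | zero =>
    have h1 : D.cherryBlossom 𝒩 x \ A = ∅ := Finset.card_eq_zero.1 (by omega)
    have h2 : A = D.cherryBlossom 𝒩 x :=
      Finset.Subset.antisymm hAC (Finset.sdiff_eq_empty_iff_subset.1 h1)
    rw [h1, h2]
    exact .refl
  | succ n ih =>
    by_cases hemp : D.cherryBlossom 𝒩 x \ A = ∅
    · exact ih A (by simp [hemp]) hxA hAC hA
    obtain ⟨u, hu⟩ := Finset.nonempty_iff_ne_empty.2 hemp
    have hCN := IsCherryForest.cherryBlossom_subset (D := D) hx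
    have pm : ∀ {v : Finset V}, v ∈ D.cherryBlossom 𝒩 x \ A →
        v ∈ 𝒩 ∧ v ∈ D.plus := by
      intro v hv
      obtain ⟨h1, h2⟩ := Finset.mem_sdiff.1 hv
      rcases mem_cherryBlossom.1 h1 with rfl | h3
      · exact (h2 hxA).elim
      · exact ⟨h3.1, h3.2.1⟩
    -- Only the last edge of this path matters: it is unmatched and joins the node `pu m` outside
    -- `A` to `A`.
    obtain ⟨lu, hlu, hlud⟩ := hF.plusPath u (pm hu).1 (pm hu).2
    obtain ⟨m, pu, qu, hm, -, hpu, hpuA, -, hqu, hmpar⟩ := hF.reaches hN hxA hA hlu hlud hu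
    obtain ⟨m, rfl⟩ : ∃ m', m = m' + 1 := ⟨m - 1, by omega⟩
    have hv := (hpu m (by omega)).1
    obtain ⟨a1, a2, a3, a4⟩ := hqu m (by omega)
    have haM : s((qu m).1, (qu m).2) ∉ D.M := by
      rw [a4]
      rw [Nat.even_add_one] at hmpar
      tauto
    -- The plus-path of `pu m` starts with a matched and returns to `A` by an unmatched edge, so it
    -- has an even number of edges. Closed up by the unmatched edge found above, it is an odd cycle
    -- through the contracted node.
    obtain ⟨lv, hlv, hlvd⟩ := hF.plusPath (pu m) (pm hv).1 (pm hv).2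
    obtain ⟨N, p, q, hN1, hp0, hp, hpA, hinj, hq, hpar⟩ := hF.reaches hN hxA hA hlv hlvd hv
    have hNe : Even N := by simpa using hpar
    obtain ⟨k, rfl⟩ := hNe.two_dvd
    -- The contracted node contains the vertices of `x`; as an original node it would be `x`, which
    -- lies in `A`.
    have hmA : merge A ∉ D.cherryBlossom 𝒩 x \ A := by
      intro h
      obtain ⟨h1, h2⟩ := Finset.mem_sdiff.1 h
      obtain ⟨a, ha⟩ := hN.1 x hx
      exact h2 (hN.eq_of_mem hx (hCN h1) ha (subset_merge hxA ha) ▸ hxA)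
    -- Index `0` is the base `merge A`. The edge at `pu m` is reversed so that it leaves the base,
    -- and the path is shifted by one, which makes the odd positions the matched ones.
    let c : ℕ → Finset V := fun i => Nat.casesOn i (merge A) p
    let e : ℕ → V × V := fun i => Nat.casesOn i (qu m).swap q
    have hcyc : IsOddCycle H D.M (insert (merge A) (D.cherryBlossom 𝒩 x \ A)) k
        (fun i => c i) (fun i => e i) := by
      refine isOddCycle_of_nat (by omega) c e ?_ ?_ ?_ ?_ ?_
      · rintro (_ | i) hi
        · exact Finset.mem_insert_self _ _
        · exact Finset.mem_insert_of_mem (hp i (by omega)).1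
      · rintro (_ | i) hi (_ | j) hj hij
        · rfl
        · exact (hmA (show merge A ∈ _ from
            (show merge A = p j from hij) ▸ (hp j (by omega)).1)).elim
        · exact (hmA (show merge A ∈ _ from
            (show p i = merge A from hij) ▸ (hp i (by omega)).1)).elim
        · rw [hinj i (by omega) j (by omega) hij]
      · rintro (_ | i) hi
        · refine ⟨subset_merge hpuA a2, a3.symm, ?_⟩
          show s((qu m).2, (qu m).1) ∈ D.M ↔ Odd 0
          rw [Sym2.eq_swap]
          simpa using haM
        · obtain ⟨b1, b2, b3, b4⟩ := hq i (by omega)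
          refine ⟨b1, b3, ?_⟩
          simp only [e, Nat.odd_add_one, Nat.not_odd_iff_even]
          simpa using b4
      · rintro (_ | i) hi
        · show (qu m).1 ∈ p 0
          rw [hp0]
          exact a1
        · exact (hq i (by omega)).2.1
      · obtain ⟨j, hj⟩ : ∃ j, 2 * k = j + 1 := ⟨2 * k - 1, by omega⟩
        rw [hj]
        have := (hq j (by omega)).2.1
        rw [← hj] at this
        exact subset_merge hpA this
    let Q : Finset (Finset V) := (Finset.range (2 * k)).image p
    have hQ : Q ⊆ D.cherryBlossom 𝒩 x \ A := by
      intro v hv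
      obtain ⟨i, hi, rfl⟩ := Finset.mem_image.1 hv
      exact (hp i (Finset.mem_range.1 hi)).1
    have himg : Finset.univ.image (fun i : Fin (2 * k + 1) => c i) = insert (merge A) Q := by
      ext v
      simp only [Finset.mem_image, Finset.mem_univ, true_and, Finset.mem_insert, Q,
        Finset.mem_range]
      constructor
      · rintro ⟨⟨_ | i, hi⟩, rfl⟩
        · exact Or.inl rfl
        · exact Or.inr ⟨i, by omega, rfl⟩
      · rintro (rfl | ⟨i, hi, rfl⟩)
        · exact ⟨⟨0, by omega⟩, rfl⟩
        · exact ⟨⟨i + 1, by omega⟩, rfl⟩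
    refine Relation.ReflTransGen.head
      (b := insert (merge (A ∪ Q)) (D.cherryBlossom 𝒩 x \ (A ∪ Q))) ?_ ?_
    · refine ⟨k, _, _, hcyc, subset_merge hxA, ?_⟩
      rw [himg, contract_insert_merge hmA]
    · have hv0 : p 0 ∈ Q := Finset.mem_image.2 ⟨0, Finset.mem_range.2 (by omega), rfl⟩
      refine ih (A ∪ Q) ?_ (Finset.mem_union_left _ hxA)
        (Finset.union_subset hAC (hQ.trans Finset.sdiff_subset)) ?_
      · have : (D.cherryBlossom 𝒩 x \ (A ∪ Q)).card < (D.cherryBlossom 𝒩 x \ A).card := by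
          refine Finset.card_lt_card (Finset.ssubset_iff_of_subset ?_ |>.2 ⟨p 0, hQ hv0, ?_⟩)
          · exact Finset.sdiff_subset_sdiff subset_rfl Finset.subset_union_left
          · intro h
            exact (Finset.mem_sdiff.1 h).2 (Finset.mem_union_right _ hv0)
        omega
      -- No matched edge leaves `A ∪ Q` within the blossom: path edges of even index are matched, so
      -- `p (2r)` and `p (2r + 1)` are mates inside `Q`.
      · intro u hu v hv hM hvA
        obtain ⟨hu1, hu2⟩ := Finset.mem_sdiff.1 hu
        rw [Finset.mem_union, not_or] at hu2
        rcases Finset.mem_union.1 hvA with hvA | hvQ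
        · exact hA u (Finset.mem_sdiff.2 ⟨hu1, hu2.1⟩) v hv hM hvA
        · obtain ⟨i, hi, rfl⟩ := Finset.mem_image.1 hvQ
          have hi := Finset.mem_range.1 hi
          obtain ⟨j, hj, hij⟩ : ∃ j < 2 * k, D.Mates (p i) (p j) := by
            rcases Nat.even_or_odd i with he | ho
            · have hlt : i + 1 < 2 * k := by
                obtain ⟨r, rfl⟩ := he
                omega
              obtain ⟨b1, b2, -, b4⟩ := hq i hi
              refine ⟨i + 1, hlt, fun h => ?_, _, b1, _, b2, by simpa using b4.2 (by simpa using he)⟩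
              have := hinj i hi (i + 1) hlt h
              omega
            · obtain ⟨r, rfl⟩ := ho
              obtain ⟨b1, b2, -, b4⟩ := hq (2 * r) (by omega)
              refine ⟨2 * r, by omega, Mates.symm ⟨fun h => ?_, _, b1, _, b2, b4.2 (by simp)⟩⟩
              have := hinj (2 * r) (by omega) (2 * r + 1) (by omega) h
              omega
          have := hF.matching.mates_unique hN (pm (hp i hi).1).1 (hCN hu1) (pm (hp j hj).1).1
            hM.symm hij
          rw [this] at hu2
          exact hu2.2 (Finset.mem_image.2 ⟨j, Finset.mem_range.2 hj, rfl⟩)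

/-- A cherry blossom is contracted by shrinking odd alternating cycles. -/
theorem IsCherryForest.shrink_cherryBlossom (hF : D.IsCherryForest H 𝒩) (hN : IsNodeSet 𝒩)
    (hx : x ∈ 𝒩) (hm : x ∉ D.minus) :
    Relation.ReflTransGen (OddCycleShrink H D.M x) (D.cherryBlossom 𝒩 x)
      {merge (D.cherryBlossom 𝒩 x)} := by
  have hxC : x ∈ D.cherryBlossom 𝒩 x := mem_cherryBlossom.2 (Or.inl rfl)
  -- The start `A = {x}` is admissible: the other blossom nodes are `±`-nodes, and so are their
  -- mates, while `x` is none.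
  have := hF.shrink_rest hN hx _ {x} le_rfl (Finset.mem_singleton_self x) (by simpa using hxC) ?_
  · rwa [merge_singleton, ← Finset.erase_eq, Finset.insert_erase hxC] at this
  · intro u hu v hv hM hvx
    rw [Finset.mem_singleton] at hvx
    subst hvx
    obtain ⟨h1, h2⟩ := Finset.mem_sdiff.1 hu
    rcases mem_cherryBlossom.1 h1 with rfl | h3
    · exact h2 (Finset.mem_singleton_self _)
    · exact hm (hF.mate hN h3.1 h3.2.1 h3.2.2.1 hv hM).2.1

/-- All cycles lie inside the cherry blossom, so the remaining nodes can be added to every stage of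
the sequence. -/
theorem IsCherryForest.shrink_to_contract (hF : D.IsCherryForest H 𝒩) (hN : IsNodeSet 𝒩)
    (hx : x ∈ 𝒩) (hm : x ∉ D.minus) :
    Relation.ReflTransGen (OddCycleShrink H D.M x) 𝒩 (contract 𝒩 (D.cherryBlossom 𝒩 x)) := by
  have hCN := IsCherryForest.cherryBlossom_subset (D := D) hx
  have := reflTransGen_oddCycleShrink_union (𝒪 := 𝒩 \ D.cherryBlossom 𝒩 x)
    (hF.shrink_cherryBlossom hN hx hm) (fun u hu => hN.1 u (hCN hu)) (fun u hu o ho => by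
      obtain ⟨h1, h2⟩ := Finset.mem_sdiff.1 ho
      exact hN.2 o h1 u (hCN hu) fun h => h2 (h ▸ hu))
  rwa [Finset.sdiff_union_of_subset hCN, Finset.union_comm, ← Finset.insert_eq] at this

end CherryData

end Blossom

namespace Blossom

/-! ### Refining a laminar family by traditional blossoms -/

open AltData

/-- Every node of an odd alternating cycle but its base has its mate in the cycle. -/
theorem IsOddCycle.exists_mates {V : Type*} {D : AltData V} {H : SimpleGraph V}
    {𝒩 : Finset (Finset V)} {k : ℕ} {c : Fin (2 * k + 1) → Finset V}
    {e : Fin (2 * k + 1) → V × V} (h : IsOddCycle H D.M 𝒩 k c e) {i : Fin (2 * k + 1)}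
    (hi : i ≠ 0) : ∃ j, D.Mates (c i) (c j) := by
  have hk := h.pos
  have succ_ne : ∀ i : Fin (2 * k + 1), i ≠ i + 1 := fun i hi => by
    have h2 := congrArg Fin.val hi
    rw [Fin.val_add_one] at h2
    split_ifs at h2 with h3
    · rw [h3, Fin.val_last] at h2
      omega
    · omega
  have step : ∀ i : Fin (2 * k + 1), Odd (i : ℕ) → D.Mates (c i) (c (i + 1)) := fun i ho =>
    ⟨fun hc => succ_ne i (h.inj hc), _, (h.edge i).1, _, (h.edge i).2.1, (h.alternating i).2 ho⟩
  -- Odd edges are matched: a node of odd index is matched to its successor, one of positive even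
  -- index to its predecessor.
  rcases Nat.even_or_odd (i : ℕ) with he | ho
  · have hpos : 0 < (i : ℕ) := Nat.pos_of_ne_zero fun h0 => hi (Fin.ext h0)
    let j : Fin (2 * k + 1) := ⟨i - 1, by omega⟩
    have hj : j + 1 = i := by
      ext
      rw [Fin.val_add_one]
      have h1 := i.2
      have : j ≠ Fin.last (2 * k) := fun hj => by
        have := congrArg Fin.val hj
        simp only [j, Fin.val_last] at this
        omega
      rw [if_neg this]
      simp only [j]
      omega
    have hodd : Odd (j : ℕ) := by
      obtain ⟨r, hr⟩ := he
      exact ⟨r - 1, by simp only [j]; omega⟩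
    exact ⟨j, by simpa [hj] using (step j hodd).symm⟩
  · exact ⟨i + 1, step i ho⟩

/-! ### Matchings and shrunk odd cycles. -/

section Contract

variable {V : Type*} [DecidableEq V] {D : AltData V} {H : SimpleGraph V}
  {𝒩 : Finset (Finset V)} {k : ℕ} {c : Fin (2 * k + 1) → Finset V} {e : Fin (2 * k + 1) → V × V}

/-- A matching remains a matching when an odd alternating cycle is shrunk. -/
theorem IsOddCycle.isMatching_contract (h : IsOddCycle H D.M 𝒩 k c e) (hN : IsNodeSet 𝒩)
    (hM : D.IsMatching H 𝒩) : D.IsMatching H (contract 𝒩 (Finset.univ.image c)) := by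
  classical
  set C := Finset.univ.image c with hC
  -- A matched edge can leave the cycle only at the base, because all other nodes have their mates
  -- in the cycle.
  have out : ∀ v ∈ 𝒩 \ C, ∀ a ∈ merge C, ∀ b ∈ v, s(a, b) ∈ D.M → a ∈ c 0 := by
    intro v hv a ha b hb hab
    obtain ⟨hv, hvC⟩ := Finset.mem_sdiff.1 hv
    obtain ⟨u, hu, hau⟩ := mem_merge.1 ha
    obtain ⟨i, -, rfl⟩ := Finset.mem_image.1 hu
    by_cases hi : i = 0
    · exact hi ▸ hau
    obtain ⟨j, hj⟩ := h.exists_mates hi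
    have hmate : D.Mates (c i) v := ⟨fun h' => hvC (h' ▸ hu), a, hau, b, hb, hab⟩
    rw [← hM.mates_unique hN (h.mem i) (h.mem j) hv hj hmate] at hvC
    exact (hvC (Finset.mem_image_of_mem c (Finset.mem_univ j))).elim
  -- For matched edges the merged node behaves like the base, so both matching conditions are pulled
  -- back along `rep`.
  let rep : Finset V → Finset V := fun u => if u = merge C then c 0 else u
  have hc0 : c 0 ∈ C := Finset.mem_image_of_mem c (Finset.mem_univ 0)
  have key : ∀ u ∈ contract 𝒩 C, ∀ v ∈ contract 𝒩 C, u ≠ v → ∀ a ∈ u, ∀ b ∈ v, s(a, b) ∈ D.M →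
      rep u ∈ 𝒩 ∧ rep v ∈ 𝒩 ∧ rep u ≠ rep v ∧ a ∈ rep u ∧ b ∈ rep v := by
    intro u hu v hv huv a ha b hb hab
    by_cases h1 : u = merge C
    · have h2 : v ≠ merge C := fun h2 => huv (h1.trans h2.symm)
      have hv' : v ∈ 𝒩 \ C := (Finset.mem_insert.1 hv).resolve_left h2
      have hv2 := Finset.mem_sdiff.1 hv'
      simp only [rep, if_pos h1, if_neg h2]
      exact ⟨h.mem 0, hv2.1, fun h3 => hv2.2 (h3 ▸ hc0), out v hv' a (h1 ▸ ha) b hb hab, hb⟩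
    · have hu' : u ∈ 𝒩 \ C := (Finset.mem_insert.1 hu).resolve_left h1
      have hu2 := Finset.mem_sdiff.1 hu'
      by_cases h2 : v = merge C
      · simp only [rep, if_neg h1, if_pos h2]
        exact ⟨hu2.1, h.mem 0, fun h3 => hu2.2 (h3 ▸ hc0), ha,
          out u hu' b (h2 ▸ hb) a ha (by rwa [Sym2.eq_swap])⟩
      · have hv2 := Finset.mem_sdiff.1 ((Finset.mem_insert.1 hv).resolve_left h2)
        simp only [rep, if_neg h1, if_neg h2]
        exact ⟨hu2.1, hv2.1, huv, ha, hb⟩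
  refine ⟨fun u hu v hv huv a ha b hb hab => ?_,
    fun u hu v hv v' hv' huv huv' a ha b hb a' ha' b' hb' hab hab' => ?_⟩
  · obtain ⟨h1, h2, h3, h4, h5⟩ := key u hu v hv huv a ha b hb hab
    exact hM.1 _ h1 _ h2 h3 a h4 b h5 hab
  · obtain ⟨h1, h2, h3, h4, h5⟩ := key u hu v hv huv a ha b hb hab
    obtain ⟨-, h2', h3', h4', h5'⟩ := key u hu v' hv' huv' a' ha' b' hb' hab'
    exact hM.2 _ h1 _ h2 _ h2' h3 h3' a h4 b h5 a' h4' b' h5' hab hab'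

theorem IsOddCycle.restrict (h : IsOddCycle H D.M 𝒩 k c e) :
    IsOddCycle H D.M (Finset.univ.image c) k c e :=
  ⟨h.pos, fun i => Finset.mem_image_of_mem c (Finset.mem_univ i), h.inj, h.edge, h.alternating⟩

theorem IsOddCycle.one_lt_card (h : IsOddCycle H D.M 𝒩 k c e) :
    1 < (Finset.univ.image c).card := by
  rw [Finset.card_image_of_injective _ h.inj, Finset.card_univ, Fintype.card_fin]
  have := h.pos
  omega

theorem IsOddCycle.image_subset (h : IsOddCycle H D.M 𝒩 k c e) : Finset.univ.image c ⊆ 𝒩 := by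
  intro u hu
  obtain ⟨i, -, rfl⟩ := Finset.mem_image.1 hu
  exact h.mem i

end Contract

variable {V : Type*} [Fintype V] [DecidableEq V] {D : AltData V} {H : SimpleGraph V}
  {𝓑 : Finset (Finset V)}

/-- The elements of `B` are the nodes of an odd alternating cycle, and their matched edges form
a matching. -/
def IsTradBlossom (D : AltData V) (H : SimpleGraph V) (𝓑 : Finset (Finset V)) (B : Finset V) :
    Prop :=
  D.IsMatching H (children 𝓑 B) ∧
    ∃ (k : ℕ) (c : Fin (2 * k + 1) → Finset V) (e : Fin (2 * k + 1) → V × V),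
      IsOddCycle H D.M (children 𝓑 B) k c e ∧ Finset.univ.image c = children 𝓑 B

theorem IsTradBlossom.congr {𝓑' : Finset (Finset V)} {B : Finset V}
    (h : IsTradBlossom D H 𝓑 B) (hc : children 𝓑' B = children 𝓑 B) :
    IsTradBlossom D H 𝓑' B := by
  unfold IsTradBlossom
  rwa [hc]

/-- The merged set of an odd cycle is a traditional blossom once it is inserted. -/
theorem IsLaminar.isTradBlossom_insert (h : IsLaminar 𝓑) {P : Finset V → Prop}
    (hP : IsLevel 𝓑 P) (hM : D.IsMatching H (maxNodes 𝓑 P)) {k : ℕ}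
    {c : Fin (2 * k + 1) → Finset V} {e : Fin (2 * k + 1) → V × V}
    (hc : IsOddCycle H D.M (maxNodes 𝓑 P) k c e) (hY : P (merge (Finset.univ.image c))) :
    IsTradBlossom D H (insert (merge (Finset.univ.image c)) 𝓑) (merge (Finset.univ.image c)) := by
  unfold IsTradBlossom
  rw [h.children_insert_self hP hc.image_subset hY hc.one_lt_card]
  exact ⟨hM.mono hc.image_subset, k, c, e, hc.restrict, rfl⟩

/-- A sequence of shrinks of odd cycles in the current graph is realized by inserting traditional
blossoms. -/
theorem IsLaminar.exists_refinement_top {𝒩 𝒩' : Finset (Finset V)}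
    (hchain : Relation.ReflTransGen (OddCycleShrink H D.M ∅) 𝒩 𝒩') (h : IsLaminar 𝓑)
    (htop : topNodes 𝓑 = 𝒩) (hM : D.IsMatching H 𝒩) (hB : ∀ B ∈ 𝓑, IsTradBlossom D H 𝓑 B) :
    ∃ 𝓑', 𝓑 ⊆ 𝓑' ∧ IsLaminar 𝓑' ∧ topNodes 𝓑' = 𝒩' ∧ D.IsMatching H 𝒩' ∧
      ∀ B ∈ 𝓑', IsTradBlossom D H 𝓑' B := by
  induction hchain using Relation.ReflTransGen.head_induction_on generalizing 𝓑 with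
  | refl => exact ⟨𝓑, subset_rfl, h, htop, hM, hB⟩
  | head hstep _ ih =>
    obtain ⟨k, c, e, hc, -, rfl⟩ := hstep
    have hN := h.isNodeSet_topNodes
    subst htop
    have hM' := hc.isMatching_contract hN hM
    rw [topNodes_eq_maxNodes] at hc hM ih hM'
    have hsub := hc.image_subset
    have hcard := hc.one_lt_card
    obtain ⟨𝓑', h1, h2, h3⟩ := ih (h.insert_merge isLevel_top hsub trivial hcard)
      (by rw [topNodes_eq_maxNodes, h.maxNodes_insert hsub trivial hcard]) hM' (fun B hB' => by
        rcases Finset.mem_insert.1 hB' with rfl | hB'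
        · exact h.isTradBlossom_insert isLevel_top hM hc trivial
        -- The merged nodes were maximal, so no older blossom properly contains the new one and
        -- older blossoms keep their elements.
        · refine (hB B hB').congr ?_
          rw [children_eq_maxNodes, children_eq_maxNodes]
          exact maxNodes_insert_of_not_maximal fun hlt =>
            (IsLaminar.not_of_merge_ssubset hsub hcard (mem_nodes.2 (Or.inr hB')) hlt
              trivial).elim)
    exact ⟨𝓑', (Finset.subset_insert _ _).trans h1, h2, h3⟩

/-- A supernode that is contracted by a sequence of shrinks of odd cycles is turned into
a traditional blossom by inserting traditional blossoms. -/
theorem IsLaminar.exists_refinement_supernode {𝒩 : Finset (Finset V)} {B : Finset V}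
    (hchain : Relation.ReflTransGen (OddCycleShrink H D.M ∅) 𝒩 {B}) (h : IsLaminar 𝓑)
    (hB : B ∈ 𝓑) (hch : children 𝓑 B = 𝒩) (hM : D.IsMatching H 𝒩) :
    ∃ 𝓑', 𝓑 ⊆ 𝓑' ∧ IsLaminar 𝓑' ∧ topNodes 𝓑' = topNodes 𝓑 ∧
      (∀ A ∈ 𝓑, A ≠ B → children 𝓑' A = children 𝓑 A) ∧
      ∀ A ∈ 𝓑', A ∉ 𝓑 ∨ A = B → IsTradBlossom D H 𝓑' A := by
  induction hchain using Relation.ReflTransGen.head_induction_on generalizing 𝓑 with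
  | refl =>
    -- An empty sequence of shrinks would make `B` an element of itself.
    have : B ∈ children 𝓑 B := by rw [hch]; exact Finset.mem_singleton_self B
    rw [children_eq_maxNodes, mem_maxNodes] at this
    exact (lt_irrefl _ this.2.1).elim
  | head hstep _ ih =>
    obtain ⟨k, c, e, hc, -, rfl⟩ := hstep
    have hN := h.isNodeSet_children B
    have hBn : B ∈ nodes 𝓑 := mem_nodes.2 (Or.inr hB)
    subst hch
    have hYB : merge (Finset.univ.image c) ⊆ B := by
      intro v hv
      obtain ⟨u, hu, hvu⟩ := mem_merge.1 hv
      rw [← merge_children (𝓑 := 𝓑) (h.1 B hB)]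
      exact subset_merge (hc.image_subset hu) hvu
    -- If the cycle covers `B`, it consists of all elements of `B`; then `B` already is a
    -- traditional blossom and nothing is inserted.
    by_cases hY : merge (Finset.univ.image c) = B
    · refine ⟨𝓑, subset_rfl, h, rfl, fun _ _ _ => rfl, fun A hA hA' => ?_⟩
      obtain rfl : A = B := hA'.resolve_left fun h' => h' hA
      refine ⟨hM, k, c, e, hc, Finset.Subset.antisymm hc.image_subset fun u hu => ?_⟩
      obtain ⟨a, ha⟩ := hN.1 u hu
      have haA : a ∈ merge (Finset.univ.image c) := by
        rw [hY, ← merge_children (𝓑 := 𝓑) (h.1 A hB)]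
        exact subset_merge hu ha
      obtain ⟨v, hv, hav⟩ := mem_merge.1 haA
      rwa [hN.eq_of_mem hu (hc.image_subset hv) ha hav]
    · have hM' := hc.isMatching_contract hN hM
      replace hY : merge (Finset.univ.image c) ⊂ B := lt_of_le_of_ne hYB hY
      have hlev := h.isLevel_children hBn
      rw [children_eq_maxNodes] at hc hM ih hM'
      have hsub := hc.image_subset
      have hcard := hc.one_lt_card
      have hlam := h.insert_merge hlev hsub hY hcard
      have hnew := h.isTradBlossom_insert hlev hM hc hY
      obtain ⟨𝓑', h1, h2, h3, h4, h5⟩ := ih hlam (Finset.mem_insert_of_mem hB)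
        (by rw [children_eq_maxNodes, h.maxNodes_insert hsub hY hcard]) hM'
      refine ⟨𝓑', (Finset.subset_insert _ _).trans h1, h2, h3.trans ?_, ?_, ?_⟩
      · rw [topNodes_eq_maxNodes, topNodes_eq_maxNodes]
        exact maxNodes_insert_of_not_maximal fun _ => ⟨B, hBn, hY, trivial⟩
      · intro A hA hAB
        rw [h4 A (Finset.mem_insert_of_mem hA) hAB, children_eq_maxNodes, children_eq_maxNodes]
        -- A supernode `A ≠ B` that properly contains the new set contains `B` as well, so the new
        -- set is not one of its elements.
        refine maxNodes_insert_of_not_maximal fun hlt => ⟨B, hBn, hY, ?_⟩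
        obtain ⟨a, ha⟩ := hN.1 (c 0) (by rw [children_eq_maxNodes]; exact hc.mem 0)
        have haY : a ∈ merge (Finset.univ.image c) :=
          subset_merge (Finset.mem_image_of_mem c (Finset.mem_univ 0)) ha
        refine lt_of_le_of_ne ?_ (Ne.symm hAB)
        rcases h.2 A hA B hB with h6 | h6 | h6
        · exact (IsLaminar.not_of_merge_ssubset hsub hcard (mem_nodes.2 (Or.inr hA)) hlt
            (lt_of_le_of_ne h6 hAB)).elim
        · exact h6
        · exact (Finset.disjoint_left.1 h6 (hlt.1 haY) (hYB haY)).elim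
      · intro A hA hA'
        by_cases hAi : A = merge (Finset.univ.image c)
        · subst hAi
          exact hnew.congr (h4 _ (Finset.mem_insert_self _ _) hY.ne)
        · refine h5 A hA (hA'.imp_left fun h6 h7 => ?_)
          exact (Finset.mem_insert.1 h7).elim hAi h6

/-- Supernodes that are contracted by sequences of shrinks of odd cycles are turned into
traditional blossoms by inserting traditional blossoms. -/
theorem IsLaminar.exists_refinement (h : IsLaminar 𝓑)
    (hB : ∀ B ∈ 𝓑, D.IsMatching H (children 𝓑 B) ∧
      Relation.ReflTransGen (OddCycleShrink H D.M ∅) (children 𝓑 B) {B}) :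
    ∃ 𝓑', 𝓑 ⊆ 𝓑' ∧ IsLaminar 𝓑' ∧ topNodes 𝓑' = topNodes 𝓑 ∧
      ∀ A ∈ 𝓑', IsTradBlossom D H 𝓑' A := by
  -- Induction on the set `𝓢` of supernodes already treated. The others have to keep their elements
  -- so that their own sequences of shrinks still apply.
  suffices H' : ∀ 𝓢 ⊆ 𝓑, ∃ 𝓑', 𝓑 ⊆ 𝓑' ∧ IsLaminar 𝓑' ∧ topNodes 𝓑' = topNodes 𝓑 ∧
      (∀ A ∈ 𝓑 \ 𝓢, children 𝓑' A = children 𝓑 A) ∧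
      ∀ A ∈ 𝓑', A ∉ 𝓑 \ 𝓢 → IsTradBlossom D H 𝓑' A by
    obtain ⟨𝓑', h1, h2, h3, -, h5⟩ := H' 𝓑 subset_rfl
    exact ⟨𝓑', h1, h2, h3, fun A hA => h5 A hA (by simp)⟩
  intro 𝓢
  induction 𝓢 using Finset.induction_on with
  | empty =>
    intro _
    exact ⟨𝓑, subset_rfl, h, rfl, fun _ _ => rfl, fun A hA hA' => (hA' (by simpa using hA)).elim⟩
  | insert B 𝓢 hBS ih =>
    intro hsub
    obtain ⟨𝓑', h1, h2, h3, h4, h5⟩ := ih ((Finset.subset_insert _ _).trans hsub)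
    have hBm : B ∈ 𝓑 := hsub (Finset.mem_insert_self _ _)
    have hBch := h4 B (Finset.mem_sdiff.2 ⟨hBm, hBS⟩)
    obtain ⟨𝓑'', g1, g2, g3, g4, g5⟩ :=
      h2.exists_refinement_supernode (hB B hBm).2 (h1 hBm) hBch (hB B hBm).1
    refine ⟨𝓑'', h1.trans g1, g2, g3.trans h3, ?_, ?_⟩
    · intro A hA
      simp only [Finset.mem_sdiff, Finset.mem_insert, not_or] at hA
      rw [g4 A (h1 hA.1) hA.2.1, h4 A (Finset.mem_sdiff.2 ⟨hA.1, hA.2.2⟩)]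
    · intro A hA hA'
      by_cases hAB : A = B
      · exact g5 A hA (Or.inr hAB)
      by_cases hAm : A ∈ 𝓑'
      · refine (h5 A hAm fun h6 => hA' ?_).congr (g4 A hAm hAB)
        simp only [Finset.mem_sdiff, Finset.mem_insert, not_or] at h6 ⊢
        exact ⟨h6.1, hAB, h6.2⟩
      · exact g5 A hA (Or.inl hAm)

end Blossom

namespace Blossom

/-! ### The traditional state that realizes a state of Blossom VI -/

open AltData CherryData

namespace CherryState

variable {V : Type*} [Fintype V] [DecidableEq V] {s : CherryState V} {H : SimpleGraph V}

theorem mem_pureTop {x : Finset V} :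
    x ∈ s.pureTop ↔ x ∈ s.top ∧ ¬ (x ∈ s.plus ∧ x ∈ s.minus) := by
  simp [pureTop]

theorem base_eq_self {x : Finset V} (hx : x ∈ s.pureTop) : s.base x = x :=
  if_neg (mem_pureTop.1 hx).2

theorem base_mem_pureTop (hF : s.IsCherryForest H s.top) {u : Finset V} (hu : u ∈ s.top) :
    s.base u ∈ s.pureTop := by
  unfold CherryData.base
  split_ifs with h
  · obtain ⟨h1, -, h3⟩ := hF.receptacle_plus u hu h.1 h.2
    exact mem_pureTop.2 ⟨h1, fun h4 => h3 h4.2⟩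
  · exact mem_pureTop.2 ⟨hu, h⟩

/-- The cherry blossoms are the fibres of `base`, hence they partition the current nodes. -/
theorem mem_cherryBlossom_iff {x u : Finset V} (hx : x ∈ s.pureTop) (hu : u ∈ s.top) :
    u ∈ s.cherryBlossom s.top x ↔ s.base u = x := by
  rw [CherryData.mem_cherryBlossom]
  unfold CherryData.base
  split_ifs with h
  · constructor
    · rintro (rfl | h1)
      · exact ((mem_pureTop.1 hx).2 h).elim
      · exact h1.2.2.2
    · exact fun h1 => Or.inr ⟨hu, h.1, h.2, h1⟩
  · constructor
    · rintro (h1 | h1)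
      · exact h1
      · exact (h ⟨h1.2.1, h1.2.2.1⟩).elim
    · exact Or.inl

theorem cherryBlossom_subset_top {x : Finset V} (hx : x ∈ s.pureTop) :
    s.cherryBlossom s.top x ⊆ s.top :=
  IsCherryForest.cherryBlossom_subset (mem_pureTop.1 hx).1

theorem mem_shrunk_iff (hN : IsNodeSet s.top) {x u : Finset V} {a : V} (hx : x ∈ s.pureTop)
    (hu : u ∈ s.top) (ha : a ∈ u) : a ∈ s.shrunk x ↔ s.base u = x := by
  rw [← mem_cherryBlossom_iff hx hu, shrunk, mem_merge]
  constructor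
  · rintro ⟨v, hv, hav⟩
    rwa [hN.eq_of_mem hu (cherryBlossom_subset_top hx hv) ha hav]
  · exact fun h => ⟨u, h, ha⟩

theorem exists_mem_of_mem_shrunk {x : Finset V} {a : V} (hx : x ∈ s.pureTop)
    (ha : a ∈ s.shrunk x) : ∃ u ∈ s.top, a ∈ u ∧ s.base u = x := by
  obtain ⟨u, hu, hau⟩ := mem_merge.1 ha
  have hu' := cherryBlossom_subset_top hx hu
  exact ⟨u, hu', hau, (mem_cherryBlossom_iff hx hu').1 hu⟩

theorem subset_shrunk (x : Finset V) : x ⊆ s.shrunk x :=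
  subset_merge (CherryData.mem_cherryBlossom.2 (Or.inl rfl))

theorem shrunk_injOn (hN : IsNodeSet s.top) {x x' : Finset V} (hx : x ∈ s.pureTop)
    (hx' : x' ∈ s.pureTop) (h : s.shrunk x = s.shrunk x') : x = x' := by
  have hxt := (mem_pureTop.1 hx).1
  obtain ⟨a, ha⟩ := hN.1 x hxt
  rw [← (mem_shrunk_iff hN hx' hxt ha).1 (h ▸ subset_shrunk x ha), base_eq_self hx]

/-- By `mate`, a matched edge at a `±`-node stays inside one cherry blossom; only matched edges
between pure nodes survive the shrinking. -/
theorem mates_shrunk_iff (hF : s.IsCherryForest H s.top) (hN : IsNodeSet s.top) {x x' : Finset V}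
    (hx : x ∈ s.pureTop) (hx' : x' ∈ s.pureTop) :
    s.Mates (s.shrunk x) (s.shrunk x') ↔ s.Mates x x' := by
  constructor
  · rintro ⟨hne, a, ha, b, hb, hM⟩
    obtain ⟨u, hu, hau, rfl⟩ := exists_mem_of_mem_shrunk hx ha
    obtain ⟨v, hv, hbv, rfl⟩ := exists_mem_of_mem_shrunk hx' hb
    have hne' : s.base u ≠ s.base v := fun h => hne (by rw [h])
    have hm : s.Mates u v := ⟨fun h => hne' (by rw [h]), a, hau, b, hbv, hM⟩
    by_cases hpm : u ∈ s.plus ∧ u ∈ s.minus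
    · obtain ⟨h1, h2, h3⟩ := hF.mate hN hu hpm.1 hpm.2 hv hm
      refine (hne' ?_).elim
      unfold CherryData.base
      rw [if_pos hpm, if_pos ⟨h1, h2⟩, h3]
    · have hpm' := hF.pure_of_mates hN hu hpm hv hm
      unfold CherryData.base
      rwa [if_neg hpm, if_neg hpm']
  · rintro ⟨hne, a, ha, b, hb, hM⟩
    exact ⟨fun h => hne (shrunk_injOn hN hx hx' h), a, subset_shrunk x ha, b, subset_shrunk x' hb,
      hM⟩

theorem mate_mem_pureTop (hF : s.IsCherryForest H s.top) (hN : IsNodeSet s.top) {x z : Finset V}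
    (hx : x ∈ s.pureTop) (hz : z ∈ s.top) (h : s.Mates x z) : z ∈ s.pureTop :=
  mem_pureTop.2 ⟨hz, hF.pure_of_mates hN (mem_pureTop.1 hx).1 (mem_pureTop.1 hx).2 hz h⟩

theorem isRoot_shrunk_iff (hF : s.IsCherryForest H s.top) (hN : IsNodeSet s.top) {x : Finset V}
    (hx : x ∈ s.pureTop) :
    s.IsRoot (s.pureTop.image s.shrunk) (s.shrunk x) ↔ s.IsRoot s.top x := by
  constructor
  · rintro ⟨-, h⟩
    refine ⟨(mem_pureTop.1 hx).1, fun v hv hM => ?_⟩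
    have hv' := mate_mem_pureTop hF hN hx hv hM
    exact h _ (Finset.mem_image_of_mem _ hv') ((mates_shrunk_iff hF hN hx hv').2 hM)
  · rintro ⟨-, h⟩
    refine ⟨Finset.mem_image_of_mem _ hx, fun v hv hM => ?_⟩
    obtain ⟨x', hx', rfl⟩ := Finset.mem_image.1 hv
    exact h x' (mem_pureTop.1 hx').1 ((mates_shrunk_iff hF hN hx hx').1 hM)

/-- Receptacles have no minus label, so `x` is the receptacle of no `±`-node. -/
theorem cherryBlossom_eq_singleton (hF : s.IsCherryForest H s.top) {x : Finset V}
    (hm : x ∈ s.minus) : s.cherryBlossom s.top x = {x} := by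
  ext v
  rw [CherryData.mem_cherryBlossom, Finset.mem_singleton]
  refine ⟨fun h => h.elim id fun h => ?_, Or.inl⟩
  exact ((hF.receptacle_plus v h.1 h.2.1 h.2.2.1).2.2 (h.2.2.2 ▸ hm)).elim

/-- All cherry blossoms of the current graph are contracted by shrinking odd cycles. -/
theorem shrink_top (hF : s.IsCherryForest H s.top) (hN : IsNodeSet s.top) :
    Relation.ReflTransGen (OddCycleShrink H s.M ∅) s.top (s.pureTop.image s.shrunk) := by
  -- `𝓢` holds the pure nodes whose cherry blossoms are already shrunk.
  suffices H' : ∀ 𝓢 ⊆ s.pureTop, Relation.ReflTransGen (OddCycleShrink H s.M ∅) s.top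
      ((s.pureTop \ 𝓢).biUnion (s.cherryBlossom s.top) ∪ 𝓢.image s.shrunk) by
    simpa using H' s.pureTop subset_rfl
  intro 𝓢
  induction 𝓢 using Finset.induction_on with
  | empty =>
    intro _
    convert Relation.ReflTransGen.refl (r := OddCycleShrink H s.M ∅) (a := s.top)
    ext u
    simp only [Finset.sdiff_empty, Finset.image_empty, Finset.union_empty, Finset.mem_biUnion]
    constructor
    · rintro ⟨x, hx, hu⟩
      exact cherryBlossom_subset_top hx hu
    · intro hu
      exact ⟨s.base u, base_mem_pureTop hF hu,
        (mem_cherryBlossom_iff (base_mem_pureTop hF hu) hu).2 rfl⟩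
  | insert x 𝓢 hxS ih =>
    intro hsub
    have hx := hsub (Finset.mem_insert_self x 𝓢)
    have hsub' : 𝓢 ⊆ s.pureTop := (Finset.subset_insert _ _).trans hsub
    refine (ih hsub').trans ?_
    have hchain : Relation.ReflTransGen (OddCycleShrink H s.M ∅) (s.cherryBlossom s.top x)
        {s.shrunk x} := by
      -- `shrink_cherryBlossom` does not ask for a plus label, so it covers free nodes too;
      -- minus-nodes have trivial blossoms.
      by_cases hm : x ∈ s.minus
      · rw [shrunk, cherryBlossom_eq_singleton hF hm, merge_singleton]
      · exact Relation.ReflTransGen.mono (fun _ _ h => h.mono (Finset.empty_subset _)) _ _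
          (hF.shrink_cherryBlossom hN (mem_pureTop.1 hx).1 hm)
    have hlift := reflTransGen_oddCycleShrink_union
      (𝒪 := (s.pureTop \ insert x 𝓢).biUnion (s.cherryBlossom s.top) ∪ 𝓢.image s.shrunk) hchain
      (fun u hu => hN.1 u (cherryBlossom_subset_top hx hu)) ?_
    · convert hlift using 1
      · have : s.pureTop \ 𝓢 = insert x (s.pureTop \ insert x 𝓢) := by
          ext z
          simp only [Finset.mem_sdiff, Finset.mem_insert, not_or]
          constructor
          · rintro ⟨h1, h2⟩
            by_cases h3 : z = x
            · exact Or.inl h3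
            · exact Or.inr ⟨h1, h3, h2⟩
          · rintro (rfl | ⟨h1, -, h2⟩)
            · exact ⟨hx, hxS⟩
            · exact ⟨h1, h2⟩
        rw [this, Finset.biUnion_insert, Finset.union_assoc, Finset.union_comm]
      · rw [Finset.image_insert, Finset.union_insert, Finset.union_comm _ {s.shrunk x},
          ← Finset.insert_eq]
    · intro u hu o ho
      have hut := cherryBlossom_subset_top hx hu
      have hub := (mem_cherryBlossom_iff hx hut).1 hu
      rw [Finset.disjoint_left]
      intro a hao hau
      rcases Finset.mem_union.1 ho with ho | ho
      · obtain ⟨x', hx', hox⟩ := Finset.mem_biUnion.1 ho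
        obtain ⟨hx'1, hx'2⟩ := Finset.mem_sdiff.1 hx'
        have hot := cherryBlossom_subset_top hx'1 hox
        have := (mem_cherryBlossom_iff hx'1 hot).1 hox
        rw [← hN.eq_of_mem hut hot hau hao, hub] at this
        exact hx'2 (this ▸ Finset.mem_insert_self _ _)
      · obtain ⟨x', hx', rfl⟩ := Finset.mem_image.1 ho
        have := (mem_shrunk_iff hN (hsub' hx') hut hau).1 hao
        rw [hub] at this
        exact hxS (this ▸ hx')

open Classical in
/-- A node that becomes `S` when all cherry blossoms are shrunk, if there is one. -/
noncomputable def unshrunk (s : CherryState V) (S : Finset V) : Finset V :=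
  if h : ∃ x ∈ s.pureTop, s.shrunk x = S then h.choose else S

theorem unshrunk_shrunk (hN : IsNodeSet s.top) {x : Finset V} (hx : x ∈ s.pureTop) :
    s.unshrunk (s.shrunk x) = x := by
  have h : ∃ z ∈ s.pureTop, s.shrunk z = s.shrunk x := ⟨x, hx, rfl⟩
  rw [unshrunk, dif_pos h]
  exact shrunk_injOn hN h.choose_spec.1 hx h.choose_spec.2

/-- The traditional state with blossoms `𝓑` in which all cherry blossoms are shrunk. -/
noncomputable def toTrad (s : CherryState V) (𝓑 : Finset (Finset V)) : TradState V where
  M := s.M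
  plus := (s.pureTop.filter fun x => x ∈ s.plus).image s.shrunk
  minus := (s.pureTop.filter fun x => x ∈ s.minus).image s.shrunk
  plusParent S := s.plusParent (s.unshrunk S)
  minusParent S := s.minusParent (s.unshrunk S)
  blossoms := 𝓑
  y := s.y

variable {𝓑 : Finset (Finset V)}

theorem shrunk_mem_plus_iff (hN : IsNodeSet s.top) {x : Finset V} (hx : x ∈ s.pureTop) :
    s.shrunk x ∈ (s.toTrad 𝓑).plus ↔ x ∈ s.plus := by
  simp only [toTrad, Finset.mem_image, Finset.mem_filter]
  constructor
  · rintro ⟨z, ⟨hz, hp⟩, h⟩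
    rwa [← shrunk_injOn hN hz hx h]
  · exact fun h => ⟨x, ⟨hx, h⟩, rfl⟩

theorem shrunk_mem_minus_iff (hN : IsNodeSet s.top) {x : Finset V} (hx : x ∈ s.pureTop) :
    s.shrunk x ∈ (s.toTrad 𝓑).minus ↔ x ∈ s.minus := by
  simp only [toTrad, Finset.mem_image, Finset.mem_filter]
  constructor
  · rintro ⟨z, ⟨hz, hp⟩, h⟩
    rwa [← shrunk_injOn hN hz hx h]
  · exact fun h => ⟨x, ⟨hx, h⟩, rfl⟩

theorem plusParent_shrunk (hN : IsNodeSet s.top) {x : Finset V} (hx : x ∈ s.pureTop) :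
    (s.toTrad 𝓑).plusParent (s.shrunk x) = s.plusParent x := by
  show s.plusParent (s.unshrunk (s.shrunk x)) = _
  rw [unshrunk_shrunk hN hx]

theorem minusParent_shrunk (hN : IsNodeSet s.top) {x : Finset V} (hx : x ∈ s.pureTop) :
    (s.toTrad 𝓑).minusParent (s.shrunk x) = s.minusParent x := by
  show s.minusParent (s.unshrunk (s.shrunk x)) = _
  rw [unshrunk_shrunk hN hx]

theorem realizedBy_toTrad (hN : IsNodeSet s.top) (hB : s.blossoms ⊆ 𝓑)
    (htop : topNodes 𝓑 = s.pureTop.image s.shrunk) : s.RealizedBy (s.toTrad 𝓑) where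
  M := rfl
  y := rfl
  blossoms := hB
  top := htop
  plus _ hx := shrunk_mem_plus_iff hN hx
  minus _ hx := shrunk_mem_minus_iff hN hx
  plusParent _ hx := plusParent_shrunk hN hx
  minusParent _ hx := minusParent_shrunk hN hx

/-- Shrinking all cherry blossoms turns an alternating path into the path of its pure nodes. -/
theorem altPath_toTrad (hF : s.IsCherryForest H s.top) (hN : IsNodeSet s.top) {v : Finset V}
    {b : Bool} {l : List (Finset V)} (h : s.AltPath s.top v b l) :
    (s.toTrad 𝓑).AltPath (s.pureTop.image s.shrunk) (s.shrunk (s.base v))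
      (if v ∈ s.plus ∧ v ∈ s.minus then true else b)
      ((l.filter fun u => u ∈ s.pureTop).map s.shrunk) := by
  induction h with
  | root r hr =>
    have hpm : ¬ (r ∈ s.plus ∧ r ∈ s.minus) := fun h => (hF.root r hr).2 h.2
    have hr' : r ∈ s.pureTop := mem_pureTop.2 ⟨hr.1, hpm⟩
    rw [if_neg hpm, base_eq_self hr', List.filter_cons_of_pos (by simpa using hr')]
    exact AltPath.root _ ((isRoot_shrunk_iff hF hN hr').2 hr)
  | plus v v' l hv hp hr hv' h2 hl ih =>
    have hmate := hF.mates_plusParent hN hv hp hr hv' h2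
    -- A `±`-node and its mate share a cherry blossom, so the step disappears; a purely plus-node
    -- has a pure mate and the step survives.
    by_cases hm : v ∈ s.minus
    · obtain ⟨hp', hm', hrec⟩ := hF.mate hN hv hp hm hv' hmate
      have hb : s.base v = s.base v' := by
        unfold CherryData.base
        rw [if_pos ⟨hp, hm⟩, if_pos ⟨hp', hm'⟩, hrec]
      rw [if_pos ⟨hp', hm'⟩] at ih
      rw [if_pos ⟨hp, hm⟩, hb,
        List.filter_cons_of_neg (by simpa using fun h => (mem_pureTop.1 h).2 ⟨hp, hm⟩)]
      exact ih
    · have hpm : ¬ (v ∈ s.plus ∧ v ∈ s.minus) := fun h => hm h.2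
      have hvp : v ∈ s.pureTop := mem_pureTop.2 ⟨hv, hpm⟩
      have hvp' := mate_mem_pureTop hF hN hvp hv' hmate
      rw [if_neg (mem_pureTop.1 hvp').2, base_eq_self hvp'] at ih
      rw [if_neg hpm, base_eq_self hvp, List.filter_cons_of_pos (by simpa using hvp),
        List.map_cons]
      refine AltPath.plus _ _ _ (Finset.mem_image_of_mem _ hvp)
        ((shrunk_mem_plus_iff hN hvp).2 hp) (fun h => hr ((isRoot_shrunk_iff hF hN hvp).1 h))
        (Finset.mem_image_of_mem _ hvp') ?_ ih
      rw [plusParent_shrunk hN hvp]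
      exact subset_shrunk v' h2
  | minus v v' l hv hm hv' h2 hl ih =>
    -- After a minus-parent comes a plus-parent, and a shrunk `±`-node continues with the
    -- plus-parent of its receptacle: both cases have type `true`.
    rw [ite_self] at ih
    by_cases hp : v ∈ s.plus
    · have hb : s.base v = s.base v' := by
        unfold CherryData.base
        rw [if_pos ⟨hp, hm⟩]
        rcases hF.successor hp hm (AltPath.minus v v' l hv hm hv' h2 hl) hl with h3 | h3
        · rw [if_neg, h3]
          intro h4
          exact (hF.receptacle_plus v hv hp hm).2.2 (h3 ▸ h4.2)
        · rw [if_pos ⟨h3.1, h3.2.1⟩, h3.2.2]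
      rw [if_pos ⟨hp, hm⟩, hb,
        List.filter_cons_of_neg (by simpa using fun h => (mem_pureTop.1 h).2 ⟨hp, hm⟩)]
      exact ih
    · have hpm : ¬ (v ∈ s.plus ∧ v ∈ s.minus) := fun h => hp h.1
      have hvp : v ∈ s.pureTop := mem_pureTop.2 ⟨hv, hpm⟩
      rw [if_neg hpm, base_eq_self hvp, List.filter_cons_of_pos (by simpa using hvp),
        List.map_cons]
      -- The minus-parent may lead to a `±`-node; after shrinking it leads to the node of its
      -- receptacle.
      refine AltPath.minus _ _ _ (Finset.mem_image_of_mem _ hvp)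
        ((shrunk_mem_minus_iff hN hvp).2 hm)
        (Finset.mem_image_of_mem _ (base_mem_pureTop hF hv')) ?_ ih
      rw [minusParent_shrunk hN hvp]
      exact (mem_shrunk_iff hN (base_mem_pureTop hF hv') hv' h2).2 rfl

theorem nodup_map_shrunk (hN : IsNodeSet s.top) {l : List (Finset V)} (hl : l.Nodup) :
    ((l.filter fun u => u ∈ s.pureTop).map s.shrunk).Nodup := by
  refine List.Nodup.map_on (fun x hx z hz h => ?_) (hl.filter _)
  rw [List.mem_filter, decide_eq_true_eq] at hx hz
  exact shrunk_injOn hN hx.2 hz.2 h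

theorem isForest_toTrad (hF : s.IsCherryForest H s.top) (hN : IsNodeSet s.top)
    (hM : s.IsMatching H (s.pureTop.image s.shrunk)) :
    (s.toTrad 𝓑).IsForest H (s.pureTop.image s.shrunk) where
  matching := hM
  root r hr := by
    obtain ⟨x, hx, rfl⟩ := Finset.mem_image.1 hr.1
    rw [shrunk_mem_plus_iff hN hx, shrunk_mem_minus_iff hN hx]
    exact hF.root x ((isRoot_shrunk_iff hF hN hx).1 hr)
  plusParent u hu hp hr := by
    obtain ⟨x, hx, rfl⟩ := Finset.mem_image.1 hu
    have hxt := (mem_pureTop.1 hx).1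
    replace hp := (shrunk_mem_plus_iff hN hx).1 hp
    replace hr : ¬ s.IsRoot s.top x := fun h => hr ((isRoot_shrunk_iff hF hN hx).2 h)
    obtain ⟨h1, ⟨v, hv, hvx, hv2⟩, h3, h4⟩ := hF.plusParent x hxt hp hr
    have hvp := mate_mem_pureTop hF hN hx hv (hF.mates_plusParent hN hxt hp hr hv hv2)
    rw [plusParent_shrunk hN hx]
    exact ⟨subset_shrunk x h1, ⟨_, Finset.mem_image_of_mem _ hvp,
      fun h => hvx (shrunk_injOn hN hvp hx h), subset_shrunk v hv2⟩, h3, h4⟩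
  minusParent u hu hm := by
    obtain ⟨x, hx, rfl⟩ := Finset.mem_image.1 hu
    have hxt := (mem_pureTop.1 hx).1
    replace hm := (shrunk_mem_minus_iff hN hx).1 hm
    obtain ⟨h1, ⟨v, hv, hvx, hv2⟩, h3, h4⟩ := hF.minusParent x hxt hm
    have hvp := base_mem_pureTop hF hv
    rw [minusParent_shrunk hN hx]
    refine ⟨subset_shrunk x h1, ⟨_, Finset.mem_image_of_mem _ hvp, fun h => hvx ?_,
      (mem_shrunk_iff hN hvp hv hv2).2 rfl⟩, h3, h4⟩
    -- The cherry blossom of a minus-node is trivial, so the other end of the minus-parent stays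
    -- outside it.
    have := (mem_cherryBlossom_iff hx hv).2 (shrunk_injOn hN hvp hx h)
    rwa [cherryBlossom_eq_singleton hF hm, Finset.mem_singleton] at this
  plusPath u hu hp := by
    obtain ⟨x, hx, rfl⟩ := Finset.mem_image.1 hu
    obtain ⟨l, hl, hnd⟩ := hF.plusPath x (mem_pureTop.1 hx).1 ((shrunk_mem_plus_iff hN hx).1 hp)
    have := altPath_toTrad (𝓑 := 𝓑) hF hN hl
    rw [base_eq_self hx, ite_self] at this
    exact ⟨_, this, nodup_map_shrunk hN hnd⟩
  minusPath u hu hm := by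
    obtain ⟨x, hx, rfl⟩ := Finset.mem_image.1 hu
    obtain ⟨l, hl, hnd⟩ := hF.minusPath x (mem_pureTop.1 hx).1
      ((shrunk_mem_minus_iff hN hx).1 hm)
    have := altPath_toTrad (𝓑 := 𝓑) hF hN hl
    rw [base_eq_self hx, if_neg (mem_pureTop.1 hx).2] at this
    exact ⟨_, this, nodup_map_shrunk hN hnd⟩

/-- The elements of a supernode are contracted by shrinking odd cycles. -/
theorem shrink_supernode {G : SimpleGraph V} {w : Sym2 V → ℝ} (hs : s.IsValid G w) {B : Finset V}
    (hB : B ∈ s.blossoms) :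
    Relation.ReflTransGen (OddCycleShrink (tightGraph G w s.y) s.M ∅) (children s.blossoms B)
      {B} := by
  obtain ⟨-, hF, r, hr, hpm⟩ := hs.supernode B hB
  have hN := hs.laminar.isNodeSet_children B
  -- All elements but `r` are `±`-nodes, so `r` is the only possible receptacle and its cherry
  -- blossom is everything.
  have hCB : s.cherryBlossom (children s.blossoms B) r = children s.blossoms B := by
    refine Finset.Subset.antisymm (IsCherryForest.cherryBlossom_subset hr.1) fun u hu => ?_
    rw [CherryData.mem_cherryBlossom]
    by_cases hur : u = r
    · exact Or.inl hur
    obtain ⟨h1, h2⟩ := hpm u hu hur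
    obtain ⟨h3, h4, h5⟩ := hF.receptacle_plus u hu h1 h2
    refine Or.inr ⟨hu, h1, h2, by_contra fun h6 => h5 (hpm _ h3 h6).2⟩
  have := hF.shrink_cherryBlossom hN hr.1 (hF.root r hr).2
  rw [hCB, merge_children (hs.laminar.1 B hB)] at this
  exact Relation.ReflTransGen.mono (fun _ _ h => h.mono (Finset.empty_subset _)) _ _ this

/-- Refining the supernodes leaves the current nodes unchanged, so `shrink_top` still describes the
shrinks needed in the current graph. -/
theorem exists_realizedBy {G : SimpleGraph V} {w : Sym2 V → ℝ} (hs : s.IsValid G w) :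
    ∃ t : TradState V, t.IsValid G w ∧ s.RealizedBy t := by
  have hF := hs.forest
  have hN : IsNodeSet s.top := hs.laminar.isNodeSet_topNodes
  obtain ⟨𝓑₁, h1, h2, h3, h4⟩ := hs.laminar.exists_refinement (D := s.toAltData)
    (H := tightGraph G w s.y)
    fun B hB => ⟨(hs.supernode B hB).2.1.matching, shrink_supernode hs hB⟩
  obtain ⟨𝓑, g1, g2, g3, g4, g5⟩ :=
    h2.exists_refinement_top (shrink_top hF hN) h3 hF.matching h4
  have hreal := realizedBy_toTrad hN (h1.trans g1) g3
  have htop : (s.toTrad 𝓑).top = _ := g3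
  refine ⟨s.toTrad 𝓑, ⟨g2, hs.feasible, fun S hS hS' => ?_, g5, ?_, ?_, ?_⟩, hreal⟩
  · exact hs.support S hS fun h => hS' (g1 (h1 h))
  · rw [htop]
    exact isForest_toTrad hF hN g4
  · rw [htop]
    intro u hu h
    obtain ⟨x, hx, rfl⟩ := Finset.mem_image.1 hu
    rw [shrunk_mem_plus_iff hN hx, shrunk_mem_minus_iff hN hx] at h
    exact (mem_pureTop.1 hx).2 h
  · rw [htop]
    intro u hu hm
    obtain ⟨x, hx, rfl⟩ := Finset.mem_image.1 hu
    obtain ⟨v, hv, hp, hM⟩ := hs.minusMatched x (mem_pureTop.1 hx).1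
      ((shrunk_mem_minus_iff hN hx).1 hm)
    have hvp := mate_mem_pureTop hF hN hx hv hM
    exact ⟨_, Finset.mem_image_of_mem _ hvp, (shrunk_mem_plus_iff hN hvp).2 hp,
      (mates_shrunk_iff hF hN hx hvp).2 hM⟩

end CherryState

end Blossom

namespace Blossom

/-! ### Stuck states -/

open AltData CherryData

namespace AltData

variable {V : Type*} {D D' : AltData V} {𝒩 : Finset (Finset V)}

/-- `D` and `D'` have the same matching and agree on the nodes in `𝒩`. -/
structure Agree (D D' : AltData V) (𝒩 : Finset (Finset V)) : Prop where
  M : D.M = D'.M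
  plus : ∀ u ∈ 𝒩, u ∈ D.plus ↔ u ∈ D'.plus
  minus : ∀ u ∈ 𝒩, u ∈ D.minus ↔ u ∈ D'.minus
  plusParent : ∀ u ∈ 𝒩, D.plusParent u = D'.plusParent u
  minusParent : ∀ u ∈ 𝒩, D.minusParent u = D'.minusParent u

theorem Agree.symm (h : Agree D D' 𝒩) : Agree D' D 𝒩 :=
  ⟨h.M.symm, fun u hu => (h.plus u hu).symm, fun u hu => (h.minus u hu).symm,
    fun u hu => (h.plusParent u hu).symm, fun u hu => (h.minusParent u hu).symm⟩

theorem Agree.mates (h : Agree D D' 𝒩) {u v : Finset V} : D.Mates u v ↔ D'.Mates u v := by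
  unfold Mates
  rw [h.M]

theorem Agree.isRoot (h : Agree D D' 𝒩) {r : Finset V} : D.IsRoot 𝒩 r ↔ D'.IsRoot 𝒩 r := by
  unfold IsRoot
  simp only [h.mates]

theorem Agree.altPath (h : Agree D D' 𝒩) {v : Finset V} {b : Bool} {l : List (Finset V)}
    (hl : D.AltPath 𝒩 v b l) : D'.AltPath 𝒩 v b l := by
  induction hl with
  | root r hr => exact .root r (h.isRoot.1 hr)
  | plus v v' l hv hp hr hv' h2 _ ih =>
    exact .plus v v' l hv ((h.plus v hv).1 hp) (fun h' => hr (h.isRoot.2 h')) hv'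
      (h.plusParent v hv ▸ h2) ih
  | minus v v' l hv hm hv' h2 _ ih =>
    exact .minus v v' l hv ((h.minus v hv).1 hm) hv' (h.minusParent v hv ▸ h2) ih

theorem Agree.inTree (h : Agree D D' 𝒩) {r v : Finset V} :
    D.InTree 𝒩 r v ↔ D'.InTree 𝒩 r v :=
  ⟨fun ⟨b, l, h1, h2⟩ => ⟨b, l, h.altPath h1, h2⟩,
    fun ⟨b, l, h1, h2⟩ => ⟨b, l, h.symm.altPath h1, h2⟩⟩

theorem InTree.mem {r v : Finset V} (h : D.InTree 𝒩 r v) : v ∈ 𝒩 := by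
  obtain ⟨b, l, h1, -⟩ := h
  exact h1.mem

theorem Agree.isFree (h : Agree D D' 𝒩) {u : Finset V} (hu : u ∈ 𝒩) :
    D.IsFree u ↔ D'.IsFree u := by
  unfold IsFree
  rw [h.plus u hu, h.minus u hu]

theorem Agree.isDualUpdate (h : Agree D D' 𝒩) {δ y y' : Finset V → ℝ}
    (hu : D.IsDualUpdate 𝒩 δ y y') : D'.IsDualUpdate 𝒩 δ y y' := by
  obtain ⟨h1, h2, h3, h4⟩ := hu
  refine ⟨fun r hr => h1 r (h.isRoot.2 hr), fun r hr => h2 r fun h' => hr (h.isRoot.1 h'),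
    fun r u hru => ?_, fun S hS => h4 S fun r hr => hS r (h.inTree.1 hr)⟩
  rw [← h.plus u hru.mem, ← h.minus u hru.mem]
  exact h3 r u (h.inTree.2 hru)

theorem Agree.dualProgress [Fintype V] [DecidableEq V] (h : Agree D D' 𝒩) {G : SimpleGraph V}
    {w : Sym2 V → ℝ} {y : Finset V → ℝ} (hp : D.DualProgress G w 𝒩 y) :
    D'.DualProgress G w 𝒩 y := by
  obtain ⟨h1, δ, ⟨y', hy', hf⟩, h3, h4⟩ := hp
  refine ⟨fun u hu => by rw [← h.plus u hu, ← h.minus u hu]; exact h1 u hu, δ,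
    ⟨y', h.isDualUpdate hy', hf⟩, h3, fun δ' ⟨z, hz, hzf⟩ => h4 δ' ⟨z, h.symm.isDualUpdate hz, hzf⟩⟩

end AltData

namespace CherryState

variable {V : Type*} [Fintype V] [DecidableEq V] {s : CherryState V} {H : SimpleGraph V}
  {G : SimpleGraph V} {w : Sym2 V → ℝ}

/-- A state in which no cherry blossom can be shrunk has no `±`-nodes. -/
theorem noPlusMinus_of_not_canShrink (hF : s.IsCherryForest H s.top) (h : ¬ s.CanShrink) :
    s.NoPlusMinus s.top := by
  intro u hu hpm
  obtain ⟨h1, h2, h3⟩ := hF.receptacle_plus u hu hpm.1 hpm.2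
  refine h ⟨s.receptacle u, h1, h2, h3, fun heq => h3 ?_⟩
  have : u ∈ s.cherryBlossom s.top (s.receptacle u) :=
    CherryData.mem_cherryBlossom.2 (Or.inr ⟨hu, hpm.1, hpm.2, rfl⟩)
  rw [heq, Finset.mem_singleton] at this
  exact this ▸ hpm.2

theorem IsStuck.noPlusMinus (hs : s.IsValid G w) (h : s.IsStuck G w) : s.NoPlusMinus s.top :=
  noPlusMinus_of_not_canShrink hs.forest fun h' => h.2.1 (Or.inr (Or.inr (Or.inr (Or.inl h'))))

theorem mem_blossoms_of_mem_top {S : Finset V} (hS : S ∈ s.top) (hcard : 1 < S.card) :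
    S ∈ s.blossoms := by
  rcases mem_nodes.1 (Finset.mem_filter.1 hS).1 with ⟨v, rfl⟩ | h
  · simp at hcard
  · exact h

/-- Without `±`-nodes, the realizing state has the same current nodes, labels and parents. -/
theorem RealizedBy.agree {t : TradState V} (h : s.RealizedBy t) (hpm : s.NoPlusMinus s.top) :
    t.top = s.top ∧ Agree t.toAltData s.toAltData s.top := by
  have hpure : s.pureTop = s.top := by
    ext x
    rw [mem_pureTop]
    exact ⟨And.left, fun hx => ⟨hx, hpm x hx⟩⟩
  have hshr : ∀ x ∈ s.top, s.shrunk x = x := by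
    intro x hx
    rw [shrunk, CherryData.cherryBlossom, Finset.filter_eq_empty_iff.2]
    · exact merge_singleton x
    · exact fun v hv hv' => hpm v hv ⟨hv'.1, hv'.2.1⟩
  refine ⟨?_, h.M, fun u hu => ?_, fun u hu => ?_, fun u hu => ?_, fun u hu => ?_⟩
  · rw [h.top, hpure, Finset.image_congr (g := id) fun x hx => hshr x hx, Finset.image_id]
  · have := h.plus u (hpure ▸ hu); rwa [hshr u hu] at this
  · have := h.minus u (hpure ▸ hu); rwa [hshr u hu] at this
  · have := h.plusParent u (hpure ▸ hu); rwa [hshr u hu] at this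
  · have := h.minusParent u (hpure ▸ hu); rwa [hshr u hu] at this

/-- Without `±`-nodes every cherry blossom is a single node. A traditional shrink is then a grow-in,
and all other operations correspond literally. -/
theorem RealizedBy.isStuck {t : TradState V} (h : s.RealizedBy t) (hs : s.IsValid G w)
    (ht : t.IsValid G w) (hst : s.IsStuck G w) : t.IsStuck G w := by
  have hpm := hst.noPlusMinus hs
  obtain ⟨htop, hag⟩ := h.agree hpm
  obtain ⟨⟨r, hr⟩, hprimal, hdual⟩ := hst
  unfold TradState.IsStuck TradState.PrimalProgress TradState.CanShrink
  rw [htop, h.y]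
  refine ⟨⟨r, hag.isRoot.2 hr⟩, ?_, fun h' => hdual (hag.dualProgress h')⟩
  rintro (⟨v, hv, x, hx, z, hz, h1, h2, h3, h4, h5⟩ | ⟨u, hu, v, hv, h1, h2, h3, r, r', h4, h5, h6⟩ |
    ⟨u, hu, v, hv, hne, h1, h2, h3, r, h4, h5⟩ | ⟨v, hv, h1, h2, h3, h4⟩)
  · exact hprimal (Or.inl ⟨v, hv, x, hx, z, hz, (hag.plus v hv).1 h1, h2, hag.mates.1 h3,
      (hag.isFree hx).1 h4, (hag.isFree hz).1 h5⟩)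
  · exact hprimal (Or.inr (Or.inr (Or.inl ⟨u, hu, v, hv, (hag.plus u hu).1 h1,
      (hag.plus v hv).1 h2, h3, r, r', hag.inTree.1 h4, hag.inTree.1 h5, h6⟩)))
  · refine hprimal (Or.inr (Or.inl ⟨u, hu, v, hv, (hag.plus u hu).1 h1, (hag.plus v hv).1 h2, ?_,
      h3, r, hag.inTree.1 h4, hag.inTree.1 h5⟩))
    unfold CherryData.base
    rwa [if_neg (hpm u hu), if_neg (hpm v hv)]
  -- A blossom of `t` that is a current node of `s` has more than one vertex, hence is a supernode
  -- of `s`.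
  · exact hprimal (Or.inr (Or.inr (Or.inr (Or.inr ⟨v, hv, (hag.minus v hv).1 h1,
      fun h' => h2 ((hag.plus v hv).2 h'),
      mem_blossoms_of_mem_top hv (ht.laminar.1 v h3), h4⟩))))

end CherryState

end Blossom

namespace Blossom

/-! ### Weak duality -/

/-- An involution without fixed points maps some element of an odd set out of it. -/
theorem exists_notMem_of_odd {V : Type*} {m : V → V} (hinv : ∀ v, m (m v) = v)
    (hne : ∀ v, m v ≠ v) {S : Finset V} (hS : Odd S.card) : ∃ v ∈ S, m v ∉ S := by
  by_contra! h
  -- If `m` preserved `S`, its elements would cancel in pairs modulo `2`.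
  have h1 : ∑ _v ∈ S, (1 : ZMod 2) = 0 :=
    Finset.sum_involution (fun v _ => m v) (fun _ _ => by decide) (fun v _ _ => hne v)
      (fun v hv => h v hv) (fun v _ => hinv v)
  rw [Finset.sum_const, nsmul_eq_mul, mul_one, ZMod.natCast_eq_zero_iff_even] at h1
  exact Nat.not_even_iff_odd.2 hS h1

section Duality

variable {V : Type*} [Fintype V] [DecidableEq V] {G : SimpleGraph V} {w : Sym2 V → ℝ}

/-- The slack of an edge as a sum over all odd sets, including the vertices. -/
theorem slack_eq_sum (w : Sym2 V → ℝ) (y : Finset V → ℝ) {a b : V} (hab : a ≠ b) :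
    slack w y a b = w s(a, b) -
      ∑ S : Finset V with Odd S.card ∧ (a ∈ S ∧ b ∉ S ∨ b ∈ S ∧ a ∉ S), y S := by
  -- The only single vertices among the odd sets separating `a` and `b` are `{a}` and `{b}`.
  have hset : (Finset.univ.filter fun S : Finset V =>
      Odd S.card ∧ (a ∈ S ∧ b ∉ S ∨ b ∈ S ∧ a ∉ S)) = insert {a} (insert {b}
        (Finset.univ.filter fun S : Finset V =>
          Odd S.card ∧ 1 < S.card ∧ (a ∈ S ∧ b ∉ S ∨ b ∈ S ∧ a ∉ S))) := by
    ext S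
    simp only [Finset.mem_filter, Finset.mem_univ, true_and, Finset.mem_insert]
    constructor
    · rintro ⟨h1, h2⟩
      by_cases h3 : 1 < S.card
      · exact Or.inr (Or.inr ⟨h1, h3, h2⟩)
      · obtain ⟨v, rfl⟩ := Finset.card_eq_one.1 (by have := h1.pos; omega : S.card = 1)
        simp only [Finset.mem_singleton] at h2
        rcases h2 with ⟨rfl, -⟩ | ⟨rfl, -⟩
        · exact Or.inl rfl
        · exact Or.inr (Or.inl rfl)
    · rintro (rfl | rfl | ⟨h1, -, h2⟩)
      · simp [hab.symm]
      · simp [hab]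
      · exact ⟨h1, h2⟩
  have hne : ({a} : Finset V) ≠ {b} := fun h => hab (Finset.singleton_inj.1 h)
  rw [hset, Finset.sum_insert (by simp [hne]), Finset.sum_insert (by simp), slack]
  ring

/-- If there is a perfect matching, the dual objective is bounded. -/
theorem exists_dual_bound {N : G.Subgraph} (hN : N.IsPerfectMatching) :
    ∃ K : ℝ, ∀ y, DualFeasible G w y → ∑ S : Finset V with Odd S.card, y S ≤ K := by
  have hex : ∀ v, ∃! u, N.Adj v u := fun v => hN.1 (hN.2 v)
  choose m hm hm' using hex
  have hinv : ∀ v, m (m v) = v := fun v => (hm' (m v) v (hm v).symm).symm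
  have hne : ∀ v, m v ≠ v := fun v h => (hm v).ne h.symm
  -- The sum over vertices counts every matching edge twice.
  refine ⟨(∑ v, w s(v, m v)) / 2, fun y hy => ?_⟩
  have h1 : 0 ≤ ∑ v, slack w y v (m v) :=
    Finset.sum_nonneg fun v _ => hy.1 v (m v) (hm v).adj_sub
  have h2 : ∑ v, slack w y v (m v) = (∑ v, w s(v, m v)) -
      ∑ S : Finset V with Odd S.card,
        ((Finset.univ.filter fun v => v ∈ S ∧ m v ∉ S ∨ m v ∈ S ∧ v ∉ S).card : ℝ) * y S := by
    simp only [slack_eq_sum w y (hne _).symm, Finset.sum_sub_distrib, Finset.sum_filter,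
      Finset.card_filter, Nat.cast_sum, Finset.sum_mul]
    rw [Finset.sum_comm]
    congr 1
    refine Finset.sum_congr rfl fun S _ => ?_
    by_cases hS : Odd S.card
    · simp [hS]
    · simp [hS]
  -- The coefficient of `y S` is the number of ends of matching edges crossing `S`. By parity it is
  -- at least `2`; for a single vertex it is exactly `2`, as needed because the variable of a vertex
  -- may be negative.
  have h3 : ∑ S : Finset V with Odd S.card, 2 * y S ≤ ∑ S : Finset V with Odd S.card,
      ((Finset.univ.filter fun v => v ∈ S ∧ m v ∉ S ∨ m v ∈ S ∧ v ∉ S).card : ℝ) * y S := by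
    refine Finset.sum_le_sum fun S hS => ?_
    have hodd : Odd S.card := (Finset.mem_filter.1 hS).2
    by_cases hcard : 1 < S.card
    · refine mul_le_mul_of_nonneg_right ?_ (hy.2 S hodd hcard)
      obtain ⟨v, hv, hmv⟩ := exists_notMem_of_odd hinv hne hodd
      have : ({v, m v} : Finset V) ⊆
          Finset.univ.filter fun v => v ∈ S ∧ m v ∉ S ∨ m v ∈ S ∧ v ∉ S := by
        intro u hu
        simp only [Finset.mem_insert, Finset.mem_singleton] at hu
        rcases hu with rfl | rfl
        · simp [hv, hmv]
        · simp [hinv, hv, hmv]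
      have := Finset.card_le_card this
      rw [Finset.card_pair (hne v).symm] at this
      exact_mod_cast this
    · obtain ⟨v, rfl⟩ := Finset.card_eq_one.1 (by have := hodd.pos; omega : S.card = 1)
      have : (Finset.univ.filter fun u => u ∈ ({v} : Finset V) ∧ m u ∉ ({v} : Finset V) ∨
          m u ∈ ({v} : Finset V) ∧ u ∉ ({v} : Finset V)) = {v, m v} := by
        ext u
        simp only [Finset.mem_filter, Finset.mem_univ, true_and, Finset.mem_singleton,
          Finset.mem_insert]
        constructor
        · rintro (⟨h, -⟩ | ⟨h, -⟩)
          · exact Or.inl h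
          · exact Or.inr (by rw [← h, hinv])
        · rintro (rfl | rfl)
          · exact Or.inl ⟨rfl, hne u⟩
          · exact Or.inr ⟨hinv v, hne v⟩
      rw [this, Finset.card_pair (hne v).symm]
      norm_num
  rw [← Finset.mul_sum] at h3
  linarith

end Duality

/-! ### Dual updates -/

open AltData CherryData

namespace AltData

variable {V : Type*} {D : AltData V} {H : SimpleGraph V} {𝒩 : Finset (Finset V)}

theorem AltPath.exists_root {v : Finset V} {b : Bool} {l : List (Finset V)}
    (h : D.AltPath 𝒩 v b l) : ∃ r, l.getLast? = some r ∧ D.IsRoot 𝒩 r := by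
  induction h with
  | root r hr => exact ⟨r, rfl, hr⟩
  | plus v v' l _ _ _ _ _ hl ih =>
    obtain ⟨r, h1, h2⟩ := ih
    obtain ⟨l', rfl⟩ := hl.exists_cons
    exact ⟨r, by rw [List.getLast?_cons_cons]; exact h1, h2⟩
  | minus v v' l _ _ _ _ hl ih =>
    obtain ⟨r, h1, h2⟩ := ih
    obtain ⟨l', rfl⟩ := hl.exists_cons
    exact ⟨r, by rw [List.getLast?_cons_cons]; exact h1, h2⟩

theorem InTree.isRoot {r v : Finset V} (h : D.InTree 𝒩 r v) : D.IsRoot 𝒩 r := by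
  obtain ⟨b, l, h1, h2⟩ := h
  obtain ⟨r', h3, h4⟩ := h1.exists_root
  rw [h2] at h3
  exact Option.some.inj h3 ▸ h4

theorem IsForest.exists_inTree (hF : D.IsForest H 𝒩) {v : Finset V} (hv : v ∈ 𝒩)
    (hl : v ∈ D.plus ∨ v ∈ D.minus) : ∃ r, D.InTree 𝒩 r v := by
  rcases hl with h | h
  · obtain ⟨l, h1, -⟩ := hF.plusPath v hv h
    obtain ⟨r, h2, -⟩ := h1.exists_root
    exact ⟨r, _, l, h1, h2⟩
  · obtain ⟨l, h1, -⟩ := hF.minusPath v hv h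
    obtain ⟨r, h2, -⟩ := h1.exists_root
    exact ⟨r, _, l, h1, h2⟩

theorem IsForest.label_of_inTree (hF : D.IsForest H 𝒩) {r v : Finset V} (h : D.InTree 𝒩 r v) :
    v ∈ D.plus ∨ v ∈ D.minus := by
  obtain ⟨b, l, h1, -⟩ := h
  cases b with
  | true => exact Or.inl (hF.label_true h1)
  | false => exact Or.inr h1.label_false

/-- A node with one label has alternating paths of one type only, and `deterministic` leaves a
single one. -/
theorem IsForest.inTree_unique (hF : D.IsForest H 𝒩) (hN : IsNodeSet 𝒩) (hpm : D.NoPlusMinus 𝒩)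
    {r r' v : Finset V} (h : D.InTree 𝒩 r v) (h' : D.InTree 𝒩 r' v) : r = r' := by
  have hno := hpm v h.mem
  obtain ⟨b, l, h1, h2⟩ := h
  obtain ⟨b', l', h1', h2'⟩ := h'
  have hb : b = b' := by
    cases b <;> cases b'
    · rfl
    · exact (hno ⟨hF.label_true h1', h1.label_false⟩).elim
    · exact (hno ⟨hF.label_true h1, h1'.label_false⟩).elim
    · rfl
  subst hb
  rw [h1.deterministic hN h1', h2'] at h2
  exact (Option.some.inj h2).symm

theorem IsRoot.inTree_self {r : Finset V} (h : D.IsRoot 𝒩 r) : D.InTree 𝒩 r r :=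
  ⟨true, [r], .root r h, rfl⟩

open Classical in
/-- The root of the tree that contains `v`. -/
noncomputable def treeRoot (D : AltData V) (𝒩 : Finset (Finset V)) (v : Finset V) : Finset V :=
  if h : ∃ r, D.InTree 𝒩 r v then h.choose else v

theorem inTree_treeRoot {v : Finset V} (h : ∃ r, D.InTree 𝒩 r v) :
    D.InTree 𝒩 (D.treeRoot 𝒩 v) v := by
  rw [treeRoot, dif_pos h]
  exact h.choose_spec

theorem IsForest.treeRoot_eq (hF : D.IsForest H 𝒩) (hN : IsNodeSet 𝒩) (hpm : D.NoPlusMinus 𝒩)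
    {r v : Finset V} (h : D.InTree 𝒩 r v) : D.treeRoot 𝒩 v = r :=
  hF.inTree_unique hN hpm (inTree_treeRoot ⟨r, h⟩) h

/-- Mates in a tree have the same root. -/
theorem IsForest.inTree_mate (hF : D.IsForest H 𝒩) (hN : IsNodeSet 𝒩) {u v : Finset V}
    (hu : u ∈ 𝒩) (hv : v ∈ 𝒩) (hp : v ∈ D.plus) (h : D.Mates u v) :
    ∃ r, D.InTree 𝒩 r u ∧ D.InTree 𝒩 r v := by
  obtain ⟨h2, l, hl⟩ := hF.minus_of_mates_plus hN hv hp hu h.symm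
  obtain ⟨r, hr, -⟩ := hl.exists_root
  refine ⟨r, ⟨false, l, hl, hr⟩, true, v :: l,
    .plus v u l hv hp (fun hroot => hroot.2 u hu h.symm) hu h2 hl, ?_⟩
  obtain ⟨l', rfl⟩ := hl.exists_cons
  rwa [List.getLast?_cons_cons]

open Classical in
/-- The sign with which the dual variable of `S` changes in a dual update. -/
noncomputable def sign (D : AltData V) (𝒩 : Finset (Finset V)) (S : Finset V) : ℝ :=
  if S ∈ 𝒩 ∧ S ∈ D.plus then 1 else if S ∈ 𝒩 ∧ S ∈ D.minus then -1 else 0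

theorem sign_plus {S : Finset V} (hS : S ∈ 𝒩) (h : S ∈ D.plus) : D.sign 𝒩 S = 1 :=
  if_pos ⟨hS, h⟩

theorem sign_minus {S : Finset V} (hS : S ∈ 𝒩) (hpm : D.NoPlusMinus 𝒩) (h : S ∈ D.minus) :
    D.sign 𝒩 S = -1 := by
  rw [sign, if_neg fun h' => hpm S hS ⟨h'.2, h⟩, if_pos ⟨hS, h⟩]

theorem sign_eq_zero {S : Finset V} (h : ¬ (S ∈ 𝒩 ∧ (S ∈ D.plus ∨ S ∈ D.minus))) :
    D.sign 𝒩 S = 0 := by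
  rw [sign, if_neg fun h' => h ⟨h'.1, Or.inl h'.2⟩, if_neg fun h' => h ⟨h'.1, Or.inr h'.2⟩]

/-- The result of the dual update with steps `δ`. -/
noncomputable def dualStep (D : AltData V) (𝒩 : Finset (Finset V)) (y δ : Finset V → ℝ)
    (S : Finset V) : ℝ :=
  y S + D.sign 𝒩 S * δ (D.treeRoot 𝒩 S)

/-- Since each labelled node has one label and one root, the steps determine the update. The
relation becomes an explicit function, affine in `δ`, which the objective and compactness arguments
use. -/
theorem IsForest.isDualUpdate_iff (hF : D.IsForest H 𝒩) (hN : IsNodeSet 𝒩)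
    (hpm : D.NoPlusMinus 𝒩) {δ y y' : Finset V → ℝ} :
    D.IsDualUpdate 𝒩 δ y y' ↔ (∀ r, D.IsRoot 𝒩 r → 0 ≤ δ r) ∧
      (∀ r, ¬ D.IsRoot 𝒩 r → δ r = 0) ∧ y' = D.dualStep 𝒩 y δ := by
  constructor
  · rintro ⟨h1, h2, h3, h4⟩
    refine ⟨h1, h2, funext fun S => ?_⟩
    by_cases hS : ∃ r, D.InTree 𝒩 r S
    · have hr := inTree_treeRoot hS
      rcases hF.label_of_inTree hr with h | h
      · rw [(h3 _ S hr).1 h, dualStep, sign_plus hr.mem h, one_mul]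
      · rw [(h3 _ S hr).2 h, dualStep, sign_minus hr.mem hpm h]
        ring
    · rw [h4 S fun r hr => hS ⟨r, hr⟩, dualStep, sign_eq_zero, zero_mul, add_zero]
      exact fun h => hS (hF.exists_inTree h.1 h.2)
  · rintro ⟨h1, h2, rfl⟩
    refine ⟨h1, h2, fun r u hr => ?_, fun S hS => ?_⟩
    · rw [dualStep, hF.treeRoot_eq hN hpm hr]
      constructor
      · intro h
        rw [sign_plus hr.mem h, one_mul]
      · intro h
        rw [sign_minus hr.mem hpm h]
        ring
    · rw [dualStep, sign_eq_zero, zero_mul, add_zero]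
      intro h
      obtain ⟨r, hr⟩ := hF.exists_inTree h.1 h.2
      exact hS r hr

variable [Fintype V] [DecidableEq V]

/-- A dual update changes the dual objective by the sum of its steps. -/
theorem IsForest.sum_dualStep (hF : D.IsForest H 𝒩) (hN : IsNodeSet 𝒩) (hpm : D.NoPlusMinus 𝒩)
    (hmm : D.MinusMatched 𝒩) (hodd : ∀ S ∈ 𝒩, Odd S.card) (y : Finset V → ℝ) {δ : Finset V → ℝ}
    (hδ : ∀ r, ¬ D.IsRoot 𝒩 r → δ r = 0) :
    ∑ S : Finset V with Odd S.card, D.dualStep 𝒩 y δ S =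
      ∑ S : Finset V with Odd S.card, y S + ∑ r, δ r := by
  classical
  simp only [dualStep, Finset.sum_add_distrib]
  congr 1
  have h1 : ∑ S : Finset V with Odd S.card, D.sign 𝒩 S * δ (D.treeRoot 𝒩 S) =
      ∑ S ∈ 𝒩, D.sign 𝒩 S * δ (D.treeRoot 𝒩 S) := by
    symm
    refine Finset.sum_subset (fun S hS => by simpa using hodd S hS) fun S _ hS => ?_
    rw [sign_eq_zero fun h => hS h.1, zero_mul]
  -- Plus-nodes are split into roots, which account for the total, and the rest, which will cancel
  -- against the minus-nodes.
  have h2 : ∀ S ∈ 𝒩, D.sign 𝒩 S * δ (D.treeRoot 𝒩 S) = (if D.IsRoot 𝒩 S then δ S else 0) +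
      ((if S ∈ D.plus ∧ ¬ D.IsRoot 𝒩 S then δ (D.treeRoot 𝒩 S) else 0) -
        if S ∈ D.minus then δ (D.treeRoot 𝒩 S) else 0) := by
    intro S hS
    by_cases hr : D.IsRoot 𝒩 S
    · obtain ⟨hp, hm⟩ := hF.root S hr
      simp [sign_plus hS hp, hr, hm, hF.treeRoot_eq hN hpm hr.inTree_self]
    · by_cases hp : S ∈ D.plus
      · have hm : S ∉ D.minus := fun hm => hpm S hS ⟨hp, hm⟩
        simp [sign_plus hS hp, hr, hp, hm]
      · by_cases hm : S ∈ D.minus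
        · simp [sign_minus hS hpm hm, hr, hp, hm]
        · rw [sign_eq_zero fun h => h.2.elim hp hm]
          simp [hr, hp, hm]
  rw [h1, Finset.sum_congr rfl h2, Finset.sum_add_distrib, Finset.sum_sub_distrib]
  have h3 : ∑ S ∈ 𝒩, (if D.IsRoot 𝒩 S then δ S else 0) = ∑ r, δ r := by
    rw [← Finset.sum_subset (Finset.subset_univ 𝒩) fun r _ hr => hδ r fun h => hr h.1]
    refine Finset.sum_congr rfl fun S _ => ?_
    split_ifs with h
    · rfl
    · exact (hδ S h).symm
  -- Mates pair the minus-nodes with the plus-nodes that are no roots, within the same tree.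
  have h4 : ∑ S ∈ 𝒩, (if S ∈ D.minus then δ (D.treeRoot 𝒩 S) else 0) =
      ∑ S ∈ 𝒩, if S ∈ D.plus ∧ ¬ D.IsRoot 𝒩 S then δ (D.treeRoot 𝒩 S) else 0 := by
    rw [← Finset.sum_filter, ← Finset.sum_filter]
    choose! m hm1 hm2 hm3 using hmm
    refine Finset.sum_bij (fun u _ => m u) ?_ ?_ ?_ ?_
    · intro u hu
      obtain ⟨hu, hum⟩ := Finset.mem_filter.1 hu
      exact Finset.mem_filter.2 ⟨hm1 u hu hum, hm2 u hu hum,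
        fun hr => hr.2 u hu (hm3 u hu hum).symm⟩
    · intro u hu u' hu' h
      obtain ⟨hu, hum⟩ := Finset.mem_filter.1 hu
      obtain ⟨hu', hum'⟩ := Finset.mem_filter.1 hu'
      exact hF.matching.mates_unique hN (hm1 u hu hum) hu hu' (hm3 u hu hum).symm
        (by rw [h]; exact (hm3 u' hu' hum').symm)
    · intro v hv
      obtain ⟨hv, hvp, hvr⟩ := Finset.mem_filter.1 hv
      obtain ⟨-, ⟨u, hu, -, hu2⟩, -⟩ := hF.plusParent v hv hvp hvr
      have hM := hF.mates_plusParent hN hv hvp hvr hu hu2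
      obtain ⟨-, l, hl⟩ := hF.minus_of_mates_plus hN hv hvp hu hM
      have hum := hl.label_false
      exact ⟨u, Finset.mem_filter.2 ⟨hu, hum⟩,
        hF.matching.mates_unique hN hu (hm1 u hu hum) hv (hm3 u hu hum) hM.symm⟩
    · intro u hu
      obtain ⟨hu, hum⟩ := Finset.mem_filter.1 hu
      obtain ⟨r, hr1, hr2⟩ := hF.inTree_mate hN hu (hm1 u hu hum) (hm2 u hu hum) (hm3 u hu hum)
      rw [hF.treeRoot_eq hN hpm hr1, hF.treeRoot_eq hN hpm hr2]
  rw [h3, h4, sub_self, add_zero]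

theorem continuous_slack_dualStep (w : Sym2 V → ℝ) (y : Finset V → ℝ) (a b : V) :
    Continuous fun δ : Finset V → ℝ => slack w (D.dualStep 𝒩 y δ) a b := by
  unfold slack dualStep
  fun_prop

theorem isClosed_dualFeasible (G : SimpleGraph V) (w : Sym2 V → ℝ) (y : Finset V → ℝ) :
    IsClosed {δ : Finset V → ℝ | DualFeasible G w (D.dualStep 𝒩 y δ)} := by
  simp only [DualFeasible, Set.ofPred_and, Set.ofPred_forall]
  refine IsClosed.inter ?_ ?_
  · exact isClosed_iInter fun a => isClosed_iInter fun b => isClosed_iInter fun _ =>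
      isClosed_le continuous_const (continuous_slack_dualStep w y a b)
  · refine isClosed_iInter fun S => isClosed_iInter fun _ => isClosed_iInter fun _ =>
      isClosed_le continuous_const ?_
    unfold dualStep
    fun_prop

/-- If feasible steps that are not all zero exist and the dual objective is bounded, a dual update
makes progress. -/
theorem IsForest.dualProgress (hF : D.IsForest H 𝒩) (hN : IsNodeSet 𝒩) (hpm : D.NoPlusMinus 𝒩)
    (hmm : D.MinusMatched 𝒩) (hodd : ∀ S ∈ 𝒩, Odd S.card) {G : SimpleGraph V} {w : Sym2 V → ℝ}
    {y : Finset V → ℝ} {K : ℝ}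
    (hK : ∀ y, DualFeasible G w y → ∑ S : Finset V with Odd S.card, y S ≤ K)
    {δ₀ : Finset V → ℝ} (h₀ : D.IsFeasibleStep G w 𝒩 y δ₀) (hpos : ∃ r, 0 < δ₀ r) :
    D.DualProgress G w 𝒩 y := by
  have hiff : ∀ δ, D.IsFeasibleStep G w 𝒩 y δ ↔ (∀ r, 0 ≤ δ r) ∧
      (∀ r, ¬ D.IsRoot 𝒩 r → δ r = 0) ∧ DualFeasible G w (D.dualStep 𝒩 y δ) := by
    intro δ
    unfold IsFeasibleStep
    simp only [hF.isDualUpdate_iff hN hpm]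
    constructor
    · rintro ⟨y', ⟨h1, h2, rfl⟩, h3⟩
      refine ⟨fun r => ?_, h2, h3⟩
      by_cases hr : D.IsRoot 𝒩 r
      · exact h1 r hr
      · exact (h2 r hr).ge
    · rintro ⟨h1, h2, h3⟩
      exact ⟨_, ⟨fun r _ => h1 r, h2, rfl⟩, h3⟩
  set P : Set (Finset V → ℝ) := {δ | D.IsFeasibleStep G w 𝒩 y δ} with hP
  have hbound : ∀ δ ∈ P, ∑ r, δ r ≤ K - ∑ S : Finset V with Odd S.card, y S := by
    intro δ hδ
    obtain ⟨-, h2, h3⟩ := (hiff δ).1 hδ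
    have := hK _ h3
    rw [hF.sum_dualStep hN hpm hmm hodd y h2] at this
    linarith
  have hclosed : IsClosed P := by
    have : P = {δ | ∀ r, 0 ≤ δ r} ∩ ({δ | ∀ r, ¬ D.IsRoot 𝒩 r → δ r = 0} ∩
        {δ | DualFeasible G w (D.dualStep 𝒩 y δ)}) := by
      ext δ
      exact hiff δ
    rw [this]
    refine IsClosed.inter ?_ (IsClosed.inter ?_ (isClosed_dualFeasible G w y))
    · simp only [Set.ofPred_forall]
      exact isClosed_iInter fun r => isClosed_le continuous_const (continuous_apply r)
    · simp only [Set.ofPred_forall]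
      exact isClosed_iInter fun r => isClosed_iInter fun _ =>
        isClosed_eq (continuous_apply r) continuous_const
  -- Steps are nonnegative with bounded sum, so they lie in a cube.
  have hcompact : IsCompact P := by
    refine IsCompact.of_isClosed_subset (isCompact_Icc (a := (0 : Finset V → ℝ))
      (b := fun _ => K - ∑ S : Finset V with Odd S.card, y S)) hclosed fun δ hδ => ?_
    have hnn := ((hiff δ).1 hδ).1
    exact ⟨hnn, fun r => (Finset.single_le_sum (fun i _ => hnn i) (Finset.mem_univ r)).trans
      (hbound δ hδ)⟩
  -- Steps of largest sum cannot be increased in any coordinate, and the sum is positive because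
  -- that of `δ₀` is.
  obtain ⟨δ, hδ, hmax⟩ := hcompact.exists_isMaxOn ⟨δ₀, h₀⟩
    (f := fun δ : Finset V → ℝ => ∑ r, δ r) (by fun_prop)
  refine ⟨hpm, δ, hδ, ?_, fun δ' hδ' hle => ?_⟩
  · by_contra! hneg
    obtain ⟨r, hr⟩ := hpos
    have h1 : ∑ r, δ r ≤ 0 := Finset.sum_nonpos fun r _ => hneg r
    have h2 : 0 < ∑ r, δ₀ r :=
      Finset.sum_pos' (fun r _ => ((hiff δ₀).1 h₀).1 r) ⟨r, Finset.mem_univ r, hr⟩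
    have h3 : ∑ r, δ₀ r ≤ ∑ r, δ r := hmax h₀
    linarith
  · have h3 : ∑ r, δ' r ≤ ∑ r, δ r := hmax hδ'
    have h4 := (Finset.sum_eq_sum_iff_of_le fun r _ => hle r).1
      (le_antisymm (Finset.sum_le_sum fun r _ => hle r) h3)
    exact funext fun r => (h4 r (Finset.mem_univ r)).symm

end AltData

end Blossom

namespace Blossom

/-! ### No perfect matching in a stuck state -/

open AltData CherryData Filter Topology

namespace CherryState

variable {V : Type*} [Fintype V] [DecidableEq V] {s : CherryState V} {G : SimpleGraph V}
  {w : Sym2 V → ℝ}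

/-- Nodes consist of an odd number of vertices. -/
theorem IsValid.odd_card (hs : s.IsValid G w) {S : Finset V} (hS : S ∈ nodes s.blossoms) :
    Odd S.card := by
  induction hn : S.card using Nat.strong_induction_on generalizing S with
  | _ n ih =>
    subst hn
    rcases mem_nodes.1 hS with ⟨v, rfl⟩ | hB
    · simp
    · have hN := hs.laminar.isNodeSet_children S
      have hcard : S.card = ∑ u ∈ children s.blossoms S, u.card := by
        conv_lhs => rw [← merge_children (𝓑 := s.blossoms) (hs.laminar.1 S hB)]
        exact Finset.card_biUnion fun u hu v hv huv => hN.2 u hu v hv huv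
      have hodd : ∀ u ∈ children s.blossoms S, Odd u.card := by
        intro u hu
        rw [children_eq_maxNodes, mem_maxNodes] at hu
        exact ih _ (Finset.card_lt_card hu.2.1) hu.1 rfl
      rw [hcard, Finset.odd_sum_iff_odd_card_odd, Finset.filter_true_of_mem hodd]
      exact (hs.supernode S hB).1

theorem IsValid.odd_card_top (hs : s.IsValid G w) {S : Finset V} (hS : S ∈ s.top) :
    Odd S.card :=
  hs.odd_card (Finset.mem_filter.1 hS).1

/-- The mate of a free node is free, and free nodes are matched. -/
theorem IsValid.exists_free_mate (hs : s.IsValid G w) {x : Finset V} (hx : x ∈ s.top)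
    (hf : s.IsFree x) : ∃ z ∈ s.top, s.Mates x z ∧ s.IsFree z := by
  have hN : IsNodeSet s.top := hs.laminar.isNodeSet_topNodes
  have hF := hs.forest
  have hr : ¬ s.IsRoot s.top x := fun h => hf.1 (hF.root x h).1
  obtain ⟨z, hz, hM⟩ : ∃ z ∈ s.top, s.Mates x z := by
    by_contra! h
    exact hr ⟨hx, h⟩
  refine ⟨z, hz, hM, fun hp => ?_, fun hm => ?_⟩
  · obtain ⟨-, l, hl⟩ := hF.minus_of_mates_plus hN hz hp hx hM.symm
    exact hf.2 hl.label_false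
  -- The mate of a minus-node is a plus-node; here that mate would be the free node `x`.
  · obtain ⟨v, hv, hvp, hM'⟩ := hs.minusMatched z hz hm
    exact hf.1 (hF.matching.mates_unique hN hz hv hx hM' hM.symm ▸ hvp)

/-- In a stuck state, no tight edge between different nodes becomes infeasible in a dual update
with equal steps. -/
theorem IsStuck.sign_add_sign_le (hs : s.IsValid G w) (h : s.IsStuck G w) {A B : Finset V}
    (hA : A ∈ s.top) (hB : B ∈ s.top) (hAB : A ≠ B) {a b : V} (ha : a ∈ A) (hb : b ∈ B)
    (hadj : (tightGraph G w s.y).Adj a b) :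
    s.sign s.top A + s.sign s.top B ≤ 0 := by
  have hpm := h.noPlusMinus hs
  have hF := hs.forest
  -- A tight edge from a plus-node must lead to a minus-node: another plus-node would allow grow-in
  -- or augment, a free node grow-out.
  have key : ∀ A ∈ s.top, ∀ B ∈ s.top, A ≠ B → Joined (tightGraph G w s.y) A B →
      A ∈ s.plus → s.sign s.top B = -1 := by
    intro A hA B hB hAB hJ hAp
    by_cases hBm : B ∈ s.minus
    · exact sign_minus hB hpm hBm
    by_cases hBp : B ∈ s.plus
    · obtain ⟨r, hr⟩ := hF.exists_inTree hA (Or.inl hAp)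
      obtain ⟨r', hr'⟩ := hF.exists_inTree hB (Or.inl hBp)
      by_cases hrr : r = r'
      · subst hrr
        refine (h.2.1 (Or.inr (Or.inl ⟨A, hA, B, hB, hAp, hBp, ?_, hJ, r, hr, hr'⟩))).elim
        unfold CherryData.base
        rwa [if_neg (hpm A hA), if_neg (hpm B hB)]
      · exact (h.2.1 (Or.inr (Or.inr
          (Or.inl ⟨A, hA, B, hB, hAp, hBp, hJ, r, r', hr, hr', hrr⟩)))).elim
    · obtain ⟨z, hz, hM, hzf⟩ := hs.exists_free_mate hB ⟨hBp, hBm⟩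
      exact (h.2.1 (Or.inl ⟨A, hA, B, hB, z, hz, hAp, hJ, hM, ⟨hBp, hBm⟩, hzf⟩)).elim
  have hle : ∀ S, S ∉ s.plus → s.sign s.top S ≤ 0 := by
    intro S hS
    unfold AltData.sign
    rw [if_neg fun h => hS h.2]
    split_ifs <;> norm_num
  by_cases hAp : A ∈ s.plus
  · rw [sign_plus hA hAp, key A hA B hB hAB ⟨a, ha, b, hb, hadj⟩ hAp]
    norm_num
  · by_cases hBp : B ∈ s.plus
    · rw [sign_plus hB hBp, key B hB A hA hAB.symm ⟨b, hb, a, ha, hadj.symm⟩ hBp]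
      norm_num
    · exact add_nonpos (hle A hAp) (hle B hBp)

/-- Signs vanish off the current nodes, which are disjoint. Hence only the current nodes of `a` and
`b` contribute, and neither does if they coincide. -/
theorem IsStuck.sum_sign_le (hs : s.IsValid G w) (h : s.IsStuck G w) {a b : V}
    (hadj : (tightGraph G w s.y).Adj a b) :
    ∑ S : Finset V with Odd S.card ∧ (a ∈ S ∧ b ∉ S ∨ b ∈ S ∧ a ∉ S), s.sign s.top S ≤ 0 := by
  have hN : IsNodeSet s.top := hs.laminar.isNodeSet_topNodes
  obtain ⟨A, hA, ha⟩ : ∃ A ∈ s.top, a ∈ A := exists_mem_topNodes a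
  obtain ⟨B, hB, hb⟩ : ∃ B ∈ s.top, b ∈ B := exists_mem_topNodes b
  by_cases hAB : A = B
  · subst hAB
    refine (Finset.sum_eq_zero fun S hS => sign_eq_zero fun hS' => ?_).le
    rcases (Finset.mem_filter.1 hS).2.2 with ⟨h1, h2⟩ | ⟨h1, h2⟩
    · exact h2 (hN.eq_of_mem hA hS'.1 ha h1 ▸ hb)
    · exact h2 (hN.eq_of_mem hA hS'.1 hb h1 ▸ ha)
  · rw [← Finset.sum_subset (s₁ := {A, B}), Finset.sum_pair hAB]
    · exact h.sign_add_sign_le hs hA hB hAB ha hb hadj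
    · intro S hS
      rw [Finset.mem_insert, Finset.mem_singleton] at hS
      simp only [Finset.mem_filter, Finset.mem_univ, true_and]
      rcases hS with rfl | rfl
      · exact ⟨hs.odd_card_top hA, Or.inl ⟨ha, fun hb' => hAB (hN.eq_of_mem hA hB hb' hb)⟩⟩
      · exact ⟨hs.odd_card_top hB, Or.inr ⟨hb, fun ha' => hAB (hN.eq_of_mem hA hB ha ha')⟩⟩
    · intro S hS hS'
      refine sign_eq_zero fun hSt => hS' ?_
      rw [Finset.mem_insert, Finset.mem_singleton]
      rcases (Finset.mem_filter.1 hS).2.2 with ⟨h1, -⟩ | ⟨h1, -⟩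
      · exact Or.inl (hN.eq_of_mem hSt.1 hA h1 ha)
      · exact Or.inr (hN.eq_of_mem hSt.1 hB h1 hb)

/-- In a stuck state, small equal steps for all trees are feasible. -/
theorem IsStuck.exists_feasibleStep (hs : s.IsValid G w) (h : s.IsStuck G w) :
    ∃ δ, s.IsFeasibleStep G w s.top s.y δ ∧ ∃ r, 0 < δ r := by
  classical
  have hN : IsNodeSet s.top := hs.laminar.isNodeSet_topNodes
  have hpm := h.noPlusMinus hs
  have hF := hs.forest
  -- All trees use the same step `ε`, which makes every dual constraint affine in `ε`.
  set z : ℝ → Finset V → ℝ := fun ε S => s.y S + s.sign s.top S * ε with hz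
  have hslack : ∀ a b, G.Adj a b → ∀ ε, slack w (z ε) a b = slack w s.y a b -
      (∑ S : Finset V with Odd S.card ∧ (a ∈ S ∧ b ∉ S ∨ b ∈ S ∧ a ∉ S), s.sign s.top S) * ε := by
    intro a b hab ε
    rw [slack_eq_sum _ _ hab.ne, slack_eq_sum _ _ hab.ne, hz, Finset.sum_add_distrib,
      Finset.sum_mul]
    ring
  -- A constraint survives small steps if it is strict, or if it is tight and its slope is
  -- nonnegative; there are finitely many constraints.
  have small : ∀ c d : ℝ, 0 ≤ c → (c = 0 → 0 ≤ d) → ∀ᶠ ε in 𝓝[>] (0 : ℝ), 0 ≤ c + d * ε := by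
    intro c d hc hd
    rcases hc.eq_or_lt with h0 | h0
    · filter_upwards [self_mem_nhdsWithin] with ε hε
      rw [← h0, zero_add]
      exact mul_nonneg (hd h0.symm) (le_of_lt hε)
    · have : Tendsto (fun ε : ℝ => c + d * ε) (𝓝[>] 0) (𝓝 (c + d * 0)) :=
        ((by fun_prop : Continuous fun ε : ℝ => c + d * ε).tendsto 0).mono_left nhdsWithin_le_nhds
      filter_upwards [this.eventually (lt_mem_nhds (by simpa using h0))] with ε hε
      exact hε.le
  have hev : ∀ᶠ ε in 𝓝[>] (0 : ℝ), DualFeasible G w (z ε) := by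
    refine Eventually.and ?_ ?_
    · rw [eventually_all]
      intro a
      rw [eventually_all]
      intro b
      by_cases hab : G.Adj a b
      · filter_upwards [small _ (-∑ S : Finset V with
            Odd S.card ∧ (a ∈ S ∧ b ∉ S ∨ b ∈ S ∧ a ∉ S), s.sign s.top S)
          (hs.feasible.1 a b hab) fun h0 => neg_nonneg.2 (h.sum_sign_le hs ⟨hab, h0⟩)] with ε hε _
        rw [hslack a b hab]
        linarith
      · exact Eventually.of_forall fun _ h' => (hab h').elim
    · rw [eventually_all]
      intro S
      by_cases hS : Odd S.card ∧ 1 < S.card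
      -- A zero variable that decreases belongs to a purely minus supernode, which could be
      -- expanded.
      · have hsign : s.y S = 0 → 0 ≤ s.sign s.top S := by
          intro h0
          unfold AltData.sign
          split_ifs with h1 h2
          · norm_num
          · exact (h.2.1 (Or.inr (Or.inr (Or.inr (Or.inr ⟨S, h2.1, h2.2, fun hp => h1 ⟨h2.1, hp⟩,
              mem_blossoms_of_mem_top h2.1 hS.2, h0⟩))))).elim
          · exact le_rfl
        filter_upwards [small _ _ (hs.feasible.2 S hS.1 hS.2) hsign] with ε hε _ _
        exact hε
      · exact Eventually.of_forall fun _ h1 h2 => (hS ⟨h1, h2⟩).elim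
  obtain ⟨ε, hε, hpos⟩ := (hev.and self_mem_nhdsWithin).exists
  have hpos : 0 < ε := hpos
  obtain ⟨r, hr⟩ := h.1
  refine ⟨fun r => if s.IsRoot s.top r then ε else 0, ⟨z ε, ?_, hε⟩, r, by simpa [hr] using hpos⟩
  rw [hF.isDualUpdate_iff hN hpm]
  refine ⟨fun r hr => by simpa [hr] using hpos.le, fun r hr => by simp [hr], funext fun S => ?_⟩
  rw [dualStep]
  by_cases hS : S ∈ s.top ∧ (S ∈ s.plus ∨ S ∈ s.minus)
  · rw [if_pos (inTree_treeRoot (hF.exists_inTree hS.1 hS.2)).isRoot]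
  · simp only [hz, sign_eq_zero hS, zero_mul]

/-- A perfect matching would bound the dual objective, and with the feasible non-zero steps of a
stuck state this would force dual progress. -/
theorem IsStuck.not_exists_isPerfectMatching (hs : s.IsValid G w) (h : s.IsStuck G w) :
    ¬ ∃ N : G.Subgraph, N.IsPerfectMatching := by
  rintro ⟨N, hN⟩
  obtain ⟨K, hK⟩ := exists_dual_bound (w := w) hN
  obtain ⟨δ, hδ, hpos⟩ := h.exists_feasibleStep hs
  exact h.2.2 (hs.forest.dualProgress hs.laminar.isNodeSet_topNodes (h.noPlusMinus hs)
    hs.minusMatched (fun S hS => hs.odd_card_top hS) hK hδ hpos)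

end CherryState

end Blossom

/-- (1) Every cherry blossom is contracted by a sequence of shrinks of odd alternating cycles.
(2) Every state of Blossom VI is realized by a state of the traditional algorithm, which is stuck if
Blossom VI is stuck. (3) If Blossom VI is stuck, there is no perfect matching. -/
theorem mainTheorem2 {V : Type*} [Fintype V] [DecidableEq V] :
    (∀ (H : SimpleGraph V) (𝒩 : Finset (Finset V)) (D : Blossom.CherryData V),
      Blossom.IsNodeSet 𝒩 → D.IsCherryForest H 𝒩 →
        ∀ x ∈ 𝒩, x ∈ D.plus → x ∉ D.minus →
          Relation.ReflTransGen (Blossom.OddCycleShrink H D.M x) 𝒩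
            (Blossom.contract 𝒩 (D.cherryBlossom 𝒩 x))) ∧
    ∀ (G : SimpleGraph V) (w : Sym2 V → ℝ) (s : Blossom.CherryState V), s.IsValid G w →
      (∃ t : Blossom.TradState V, t.IsValid G w ∧ s.RealizedBy t ∧
        (s.IsStuck G w → t.IsStuck G w)) ∧
      (s.IsStuck G w → ¬ ∃ N : G.Subgraph, N.IsPerfectMatching) := by
  refine ⟨fun H 𝒩 D hN hF x hx _ hm => hF.shrink_to_contract hN hx hm, fun G w s hs => ⟨?_, ?_⟩⟩
  · obtain ⟨t, ht, hst⟩ := Blossom.CherryState.exists_realizedBy hs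
    exact ⟨t, ht, hst, fun h => hst.isStuck hs ht h⟩
  · exact fun h => h.not_exists_isPerfectMatching hs
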